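/- **Setting.** A self-join-free conjunctive query $q(\vec x) \,{:\!-}\, R_1(\vec x_1),\dots,R_m(\vec x_m)$, $m\ge 1$, has one atom for each of the distinct relation symbols $R_1,\dots,R_m$; the arguments are variables or constants, and every head variable occurs in some atom. $\mathrm{Var}$ denotes sets of variables, $\mathrm{HVar}(q)$ the head variables and $\mathrm{EVar}(q)=\mathrm{Var}(q)\setminus\mathrm{HVar}(q)$ the existential variables. The query is *safe* (hierarchical) if for any two existential variables $x,y$ the sets $sg(x),sg(y)$ of atoms containing them are disjoint or one contains the other. A database $D$ is a finite set of tuples $t$, independently present with probability $p(t)\in[0,1]$; its active domain $A$ is the set of constants that occur in it. For an assignment $\vec a$ of constants to the head variables, the *reliability* $r(q)$ is the probability that $q$ with $\vec a$ substituted for its head variables is true in a random possible world. A *dissociation* is $\Delta=(\vec y_1,\dots,\vec y_m)$ with $\vec y_i\subseteq \mathrm{Var}(q)\setminus\mathrm{Var}(R_i(\vec x_i))$. The query $q^\Delta$ has the atoms $R_i^{\vec y_i}(\vec x_i,\vec y_i)$ and the same head variables; it is evaluated over the database in which every tuple of $R_i$ is replaced by one independent copy, with the same probability, for each value of $\vec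 y_i$ in $A^{|\vec y_i|}$. Write $\Delta'\preceq\Delta$ if $\vec y'_i\subseteq\vec y_i$ for all $i$. $\Delta$ is *safe* if $q^\Delta$ is safe. The *propagation score* is $\rho(q)=\min_\Delta r(q^\Delta)$ over the safe dissociations. *Plans* are given by $P ::= R_i(\vec x_i)\mid \pi_{-\vec y}P\mid\ \bowtie\!(P_1,\dots,P_k)$ with unordered joins, $k\ge 2$, joins and projections alternating, and $\vec y\neq\emptyset$ a set of head variables of $P$ that is projected away. The head variables are $\mathrm{HVar}(R_i(\vec x_i))=\mathrm{Var}(R_i(\vec x_i))$, $\mathrm{HVar}(\pi_{-\vec y}P)=\mathrm{HVar}(P)\setminus \vec y$, and for a join the union of those of the operands. $P$ is a plan *for* $q$ if each atom of $q$ occurs in it exactly once and no others occur, $\mathrm{HVar}(P)=\mathrm{HVar}(q)$, each variable is projected away at most once, and head variables of $q$ are never projected away. The *score* of $P$ for values $\vec a$ of the head variables is computed extensionally: an atom has the probability of its tuple ($0$ if absent), a join multiplies the probabilities of the operands, and a projection gives $1-\prod(1-p_i)$ over all values of the removed variables in $A$. The dissociation $\Delta_P$ of a plan $P$ for $q$ adds,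 at each join $\bowtie\!(P_1,\dots,P_k)$ in $P$, to every relation in $P_j$ the existential variables of $q$ in $\bigcup_i\mathrm{HVar}(P_i)\setminus\mathrm{HVar}(P_j)$. $P$ is a *minimal plan* for $q$ if $\Delta_P$ is minimal, with respect to $\preceq$, among all safe dissociations of $q$. A plan $P'$ *dominates* $P$ if $P'\ne P$ and $\Delta_{P'}\preceq\Delta_P$. The query is *connected* if its atoms are connected by chains of atoms in which consecutive atoms share an existential variable. $\mathrm{TopSet}(q)$ is the set of inclusion-minimal sets $\vec y\subseteq\mathrm{EVar}(q)$ such that $q$ becomes disconnected when $\vec y$ is moved to the head variables. **Algorithm** $\mathrm{MP}(q)$. - If $m=1$: return the one plan $\pi_{-\mathrm{EVar}(q)}R_1(\vec x_1)$ (just $R_1(\vec x_1)$ if $\mathrm{EVar}(q)=\emptyset$). - If $m\ge2$ and $q$ is disconnected: let $q_1,\dots,q_k$ be its components connected by existential variables, with $\mathrm{HVar}(q_i)=\mathrm{HVar}(q)\cap\mathrm{Var}(q_i)$; return all $\bowtie\!(P_1,\dots,P_k)$ with $P_i\in\mathrm{MP}(q_i)$. - If $m\ge2$ and $q$ is connected: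 return all $\pi_{-\vec y}P$ with $\vec y\in\mathrm{TopSet}(q)$ and $P\in\mathrm{MP}(q')$, where $q'$ is $q$ with $\mathrm{HVar}(q')=\mathrm{HVar}(q)\cup\vec y$. **Theorem.** For every self-join-free conjunctive query $q$, $\mathrm{MP}(q)$ is exactly the set of minimal plans for $q$. Moreover: 1. (Soundness) every $P\in\mathrm{MP}(q)$ is a plan for $q$ that is not dominated by any plan for $q$; 2. (Completeness) for every database and every assignment of constants to the head variables, the minimum defining $\rho(q)$ is attained, and the minimum of $\mathrm{score}(P)$ over $P\in\mathrm{MP}(q)$ is attained and equals $\rho(q)$. -/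

import Mathlib

namespace ProbDB

noncomputable section

open scoped Classical

universe u v w z

variable {Rel : Type u} {V : Type v} {C : Type w} {attr : Rel → Type z}

/-! ### Self-join-free conjunctive queries -/

/-- A self-join-free conjunctive query over a relational vocabulary `Rel` in which the relation `r`
has the attributes `attr r`, with variables in `V` and constants in `C`.  The body consists of one
atom for each relation symbol `r ∈ rels`; the arguments of that atom (variables or constants) are
given by `args r`.  The values of `args` outside `rels` play no role. -/
structure Query (attr : Rel → Type z) (V : Type v) (C : Type w) where
  rels : Finset Rel
  args : (r : Rel) → attr r → V ⊕ C
  head : Finset V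

namespace Query

variable [∀ r, Fintype (attr r)]

/-- The variables of the atom with relation symbol `r`. -/
def varsOf (q : Query attr V C) (r : Rel) : Finset V :=
  Finset.univ.biUnion fun i : attr r => Sum.elim (fun x => {x}) (fun _ => ∅) (q.args r i)

/-- All variables of a query. -/
def vars (q : Query attr V C) : Finset V := q.rels.biUnion q.varsOf

/-- The existential (non-head) variables. -/
def evars (q : Query attr V C) : Finset V := q.vars \ q.head

/-- The subgoals that contain `x`. -/
def sg (q : Query attr V C) (x : V) : Finset Rel := q.rels.filter fun r => x ∈ q.varsOf r

/-- Hierarchical queries, i.e. the safe self-join-free conjunctive queries. -/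
def Hierarchical (q : Query attr V C) : Prop :=
  ∀ x ∈ q.evars, ∀ y ∈ q.evars,
    q.sg x ⊆ q.sg y ∨ Disjoint (q.sg x) (q.sg y) ∨ q.sg y ⊆ q.sg x

/-- Two subgoals that share an existential variable. -/
def Adj (q : Query attr V C) (r s : Rel) : Prop :=
  r ∈ q.rels ∧ s ∈ q.rels ∧ ∃ x ∈ q.evars, x ∈ q.varsOf r ∧ x ∈ q.varsOf s

/-- Two subgoals connected by a chain of subgoals, consecutive ones sharing an existential
variable. -/
def Linked (q : Query attr V C) : Rel → Rel → Prop := Relation.ReflTransGen q.Adj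

/-- All subgoals are connected through existential variables. -/
def Connected (q : Query attr V C) : Prop := ∀ r ∈ q.rels, ∀ s ∈ q.rels, q.Linked r s

/-- The components of the body connected by the existential variables. -/
def components (q : Query attr V C) : Finset (Finset Rel) :=
  q.rels.image fun r => q.rels.filter fun s => q.Linked r s

/-- The subquery with body `S`; its head variables are those of `q` that occur in `S`. -/
def restrict (q : Query attr V C) (S : Finset Rel) : Query attr V C where
  rels := S
  args := q.args
  head := q.head ∩ S.biUnion q.varsOf

/-- The query in which the variables `y` are added to the head variables. -/
def addHead (q : Query attr V C) (y : Finset V) : Query attr V C where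
  rels := q.rels
  args := q.args
  head := q.head ∪ y

/-- The minimal sets of existential variables whose removal (i.e. move to the head) disconnects
the query. -/
def topSets (q : Query attr V C) : Finset (Finset V) :=
  q.evars.powerset.filter fun y =>
    ¬ (q.addHead y).Connected ∧ ∀ y', y' ⊂ y → (q.addHead y').Connected

/-- A dissociation `Δ` adds to the subgoal of `r` the variables `Δ r`, which are variables of `q`
that do not occur in that subgoal (nothing is added to relations outside `q`). Dissociations are
ordered by inclusion in every component. -/
def IsDissociation (q : Query attr V C) (Δ : Rel → Finset V) : Prop :=
  (∀ r ∈ q.rels, Δ r ⊆ q.vars \ q.varsOf r) ∧ ∀ r, r ∉ q.rels → Δ r = ∅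

end Query

/-- The attributes of the dissociated schema: `r` gets one new attribute for every variable in
`Δ r`. -/
abbrev DissAttr (attr : Rel → Type z) (Δ : Rel → Finset V) (r : Rel) : Type (max v z) :=
  attr r ⊕ {y : V // y ∈ Δ r}

namespace Query

/-- The dissociated query, over the dissociated schema. -/
def dissociate (q : Query attr V C) (Δ : Rel → Finset V) : Query (DissAttr attr Δ) V C where
  rels := q.rels
  args := fun r => Sum.elim (q.args r) (fun y => Sum.inl y.1)
  head := q.head

/-- Safe dissociations: the dissociated query is safe. -/
def IsSafeDissociation [∀ r, Fintype (attr r)] (q : Query attr V C) (Δ : Rel → Finset V) : Prop :=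
  q.IsDissociation Δ ∧ (q.dissociate Δ).Hierarchical

end Query

/-! ### Tuple-independent probabilistic databases -/

/-- A finite collection of tuples, each with a probability. -/
structure Database (attr : Rel → Type z) (C : Type w) where
  tuples : Finset (Σ r, attr r → C)
  prob : (Σ r, attr r → C) → ℝ
  prob_mem : ∀ t ∈ tuples, prob t ∈ Set.Icc (0 : ℝ) 1

namespace Database

/-- The constants that occur in the database. -/
def activeDomain [∀ r, Fintype (attr r)] (D : Database attr C) : Finset C :=
  D.tuples.biUnion fun t => Finset.univ.image t.2

/-- The probability of the possible world `W ⊆ D.tuples`. -/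
def worldProb (D : Database attr C) (W : Finset (Σ r, attr r → C)) : ℝ :=
  (∏ t ∈ W, D.prob t) * ∏ t ∈ D.tuples \ W, (1 - D.prob t)

/-- The dissociated database: every tuple of `r` is copied once for each way to give the new
attributes `Δ r` values in the active domain; each copy is an independent tuple with the
probability of the original. -/
def dissociate [∀ r, Fintype (attr r)] (D : Database attr C) (Δ : Rel → Finset V) :
    Database (DissAttr attr Δ) C where
  tuples := D.tuples.biUnion fun t =>
    (Fintype.piFinset fun _ : {y : V // y ∈ Δ t.1} => D.activeDomain).image fun τ =>
      (⟨t.1, Sum.elim t.2 τ⟩ : Σ r, DissAttr attr Δ r → C)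
  prob := fun t => D.prob ⟨t.1, fun i => t.2 (Sum.inl i)⟩
  prob_mem := by
    intro t ht
    simp only [Finset.mem_biUnion, Finset.mem_image] at ht
    obtain ⟨s, hs, τ, -, rfl⟩ := ht
    exact D.prob_mem s hs

end Database

/-- The tuple that instantiates the atom of `r` under the assignment `μ` of the variables. -/
def Query.ground (q : Query attr V C) (μ : V → C) (r : Rel) : Σ r, attr r → C :=
  ⟨r, fun i => Sum.elim μ id (q.args r i)⟩

/-- The query holds in the world `W` for the answer that assigns `ν` to the head variables. -/
def Query.HoldsIn (q : Query attr V C) (W : Finset (Σ r, attr r → C)) (ν : V → C) : Prop :=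
  ∃ μ : V → C, (∀ x ∈ q.head, μ x = ν x) ∧ ∀ r ∈ q.rels, q.ground μ r ∈ W

/-- The reliability of the answer `ν` (only its values on the head variables matter): the
probability that the query is true in a random possible world. -/
def reliability (D : Database attr C) (q : Query attr V C) (ν : V → C) : ℝ :=
  ∑ W ∈ D.tuples.powerset.filter (fun W => q.HoldsIn W ν), D.worldProb W

/-- The propagation score: the minimal reliability of the safe dissociations. -/
def propagationScore [∀ r, Fintype (attr r)] (D : Database attr C) (q : Query attr V C)
    (ν : V → C) : ℝ :=
  sInf {p | ∃ Δ, q.IsSafeDissociation Δ ∧ p = reliability (D.dissociate Δ) (q.dissociate Δ) ν}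

/-! ### Query plans -/

/-- Query plans: atoms, project-away operators (the variables `y` are projected away) and
joins.  Joins are not ordered: as no relation symbol is used twice, the operands of a join are
told apart by the sets of relation symbols they mention, and these sets index the operands. -/
inductive Plan (Rel : Type u) (V : Type v) : Type (max u v)
  | atom (r : Rel) : Plan Rel V
  | proj (y : Finset V) (P : Plan Rel V) : Plan Rel V
  | join (parts : Finset (Finset Rel)) (P : {S : Finset Rel // S ∈ parts} → Plan Rel V) :
      Plan Rel V

namespace Plan

/-- The relation symbols mentioned in a plan. -/
def rels : Plan Rel V → Finset Rel
  | atom r => {r}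
  | proj _ P => P.rels
  | join _ P => Finset.univ.biUnion fun S => (P S).rels

def IsProj : Plan Rel V → Prop
  | proj _ _ => True
  | _ => False

def IsJoin : Plan Rel V → Prop
  | join _ _ => True
  | _ => False

/-- The number of project operators that project the variable `x` away. -/
def projCount (x : V) : Plan Rel V → ℕ
  | atom _ => 0
  | proj y P => (if x ∈ y then 1 else 0) + P.projCount x
  | join _ P => ∑ S, (P S).projCount x

variable [∀ r, Fintype (attr r)]

/-- The head variables of a plan over the atoms of `q`. -/
def hvars (q : Query attr V C) : Plan Rel V → Finset V
  | atom r => q.varsOf r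
  | proj y P => P.hvars q \ y
  | join _ P => Finset.univ.biUnion fun S => (P S).hvars q

/-- The grammar of plans: a projection removes a nonempty set of head variables, a join has at
least two operands, the operands of a join mention disjoint sets of relation symbols and are
indexed by these sets, and joins and projections alternate. -/
def WellFormed (q : Query attr V C) : Plan Rel V → Prop
  | atom _ => True
  | proj y P => y.Nonempty ∧ y ⊆ P.hvars q ∧ ¬ P.IsProj ∧ P.WellFormed q
  | join parts P => 2 ≤ parts.card ∧ (∀ S, (P S).rels = S.1) ∧
      (∀ S ∈ parts, ∀ T ∈ parts, S ≠ T → Disjoint S T) ∧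
      ∀ S, ¬ (P S).IsJoin ∧ (P S).WellFormed q

/-- `P` is a plan for the query `q`: it is made of the atoms of `q`, it has the head variables of
`q`, every variable is projected away at most once, and head variables of `q` never are. -/
def IsPlanFor (q : Query attr V C) (P : Plan Rel V) : Prop :=
  P.WellFormed q ∧ P.rels = q.rels ∧ P.hvars q = q.head ∧
    (∀ x, P.projCount x ≤ 1) ∧ ∀ x ∈ q.head, P.projCount x = 0

/-- The dissociation that corresponds to a plan: at each join, every relation mentioned in an
operand is dissociated on the existential variables that are head variables of the join but not
of this operand. -/
def dissociation (q : Query attr V C) : Plan Rel V → Rel → Finset V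
  | atom _ => fun _ => ∅
  | proj _ P => P.dissociation q
  | join _ P => fun r => Finset.univ.biUnion fun S =>
      if r ∈ (P S).rels then
        (((Finset.univ.biUnion fun T => (P T).hvars q) \ (P S).hvars q) ∩ q.evars) ∪
          (P S).dissociation q r
      else ∅

/-- `P'` dominates `P`: they are different plans and the dissociation of `P'` is below that of `P`
in the partial dissociation order. -/
def Dominates (q : Query attr V C) (P' P : Plan Rel V) : Prop :=
  P' ≠ P ∧ P'.dissociation q ≤ P.dissociation q

/-- Minimal query plans: the corresponding dissociation is minimal among all safe dissociations. -/
def IsMinimalFor (q : Query attr V C) (P : Plan Rel V) : Prop :=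
  P.IsPlanFor q ∧ Minimal q.IsSafeDissociation (P.dissociation q)

/-- The score of a plan under the extensional semantics, for the values `ν` of the head variables
of the plan (tuples that are absent from an intermediate relation have probability `0`): joins
multiply probabilities, projections combine them by independent-or. -/
def score (D : Database attr C) (q : Query attr V C) : Plan Rel V → (V → C) → ℝ
  | atom r => fun ν => if q.ground ν r ∈ D.tuples then D.prob (q.ground ν r) else 0
  | proj y P => fun ν =>
      1 - ∏ τ ∈ Fintype.piFinset (fun _ : {x : V // x ∈ y} => D.activeDomain),
        (1 - P.score D q (fun x => if h : x ∈ y then τ ⟨x, h⟩ else ν x))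
  | join _ P => fun ν => ∏ S, (P S).score D q ν

end Plan

/-! ### The recursive algorithm -/

section Algorithm

variable [∀ r, Fintype (attr r)]

theorem Query.Linked.symm {q : Query attr V C} {r s : Rel} (h : q.Linked r s) : q.Linked s r := by
  have hadj : ∀ a b, q.Adj a b → q.Adj b a := by
    rintro a b ⟨ha, hb, x, hx, h1, h2⟩
    exact ⟨hb, ha, x, hx, h2, h1⟩
  induction h with
  | refl => exact Relation.ReflTransGen.refl
  | tail _ hbc ih => exact Relation.ReflTransGen.head (hadj _ _ hbc) ih

theorem Query.card_lt_of_mem_components {q : Query attr V C} (hq : ¬ q.Connected)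
    {S : Finset Rel} (hS : S ∈ q.components) : S.card < q.rels.card := by
  obtain ⟨r, hr, rfl⟩ := Finset.mem_image.1 hS
  refine Finset.card_lt_card (Finset.filter_ssubset.2 ?_)
  by_contra! hcon
  exact hq fun a ha b hb => Relation.ReflTransGen.trans (hcon a ha).symm (hcon b hb)

theorem Query.card_evars_addHead_lt {q : Query attr V C} (hq : q.Connected)
    {y : Finset V} (hy : y ∈ q.topSets) : (q.addHead y).evars.card < q.evars.card := by
  obtain ⟨hsub, hdis, -⟩ := Finset.mem_filter.1 hy
  rw [Finset.mem_powerset] at hsub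
  have hne : y.Nonempty := by
    rw [Finset.nonempty_iff_ne_empty]
    rintro rfl
    apply hdis
    have : q.addHead ∅ = q := by simp [Query.addHead]
    rwa [this]
  obtain ⟨x, hx⟩ := hne
  refine Finset.card_lt_card ((Finset.ssubset_iff_of_subset ?_).2 ⟨x, hsub hx, ?_⟩)
  · intro a ha
    have ha' : a ∈ q.vars \ (q.head ∪ y) := ha
    simp only [Finset.mem_sdiff, Finset.mem_union, not_or] at ha'
    exact Finset.mem_sdiff.2 ⟨ha'.1, ha'.2.1⟩
  · intro hx'
    exact (Finset.mem_sdiff.1 hx').2 (Finset.mem_union_right _ hx)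

/-- The recursive algorithm `MP`.  For a single subgoal the plan projects on the head variables
(no operator is needed if there are no existential variables).  A connected query is projected on
each of its top sets.  For a disconnected query, the plans of its components are joined, in all
combinations. -/
def MP (q : Query attr V C) : Finset (Plan Rel V) :=
  if q.rels.card = 1 then
    q.rels.image fun r => if q.evars = ∅ then Plan.atom r else Plan.proj q.evars (Plan.atom r)
  else if hq : q.Connected then
    q.topSets.attach.biUnion fun y => (MP (q.addHead y.1)).image (Plan.proj y.1)
  else
    (Fintype.piFinset fun S : {S // S ∈ q.components} => MP (q.restrict S.1)).image
      (Plan.join q.components)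
termination_by (q.rels.card, q.evars.card)
decreasing_by
  · exact Prod.Lex.right _ (Query.card_evars_addHead_lt hq y.2)
  · exact Prod.Lex.left _ _ (Query.card_lt_of_mem_components hq S.2)

end Algorithm

end

end ProbDB

/-! A plan for `q` is encoded by its scopes: to each atom, the set of variables projected away above
it. For a plan, `dissociation` at `r` is the scope of `r` minus the variables of `r`, and the scope
is recovered as the non-head variables of the dissociated atom (`IsPlanFor.dissociation_eq`,
`IsPlanFor.scope_eq`). Hence the order on dissociations is the order on scopes. The atoms below the
projections on two variables are nested or disjoint (`Proper.laminar`), which is exactly safety of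
the dissociation. Since joins and projections alternate, the scopes also determine the plan
(`Proper.eq_of_scope_eq`).

The combinatorial core is that every safe dissociation lies above a plan in `MP q`
(`exists_mem_MP_scope_subset`). If `q` has at least two atoms, the variables that a laminar
labelling assigns to all atoms already disconnect it (`IsLabelling.not_connected`). They therefore
contain a top set to project on, and the recursion continues with what remains. Plans in `MP q` are
moreover pairwise incomparable, because top sets form an antichain. Together these facts identify
`MP q` with the minimal plans.

Two probabilistic facts give completeness. In the query dissociated along a plan, a projected
variable occurs in every atom below its projection, so the operands of each operator depend on
disjoint sets of tuples and the score is a true probability (`IsPlanFor.score_eq_reliability`).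
Enlarging a dissociation replaces the variables of a monotone DNF by independent copies, never two
copies in one conjunct, which can only raise the probability (`expect_le_expect_of_copies`,
`reliability_dissociate_mono`). So the reliability of any safe dissociation is bounded below by the
score of some plan in `MP q`, and these scores are themselves such reliabilities. -/

namespace ProbDB

noncomputable section

open scoped Classical

universe u v w z z'

variable {Rel : Type u} {V : Type v} {C : Type w} {attr : Rel → Type z} {attr' : Rel → Type z'}

namespace Plan

/-! ### The variables projected away above an atom -/

/-- The variables that are projected away above the atom of `r`. -/
def scope : Plan Rel V → Rel → Finset V
  | atom _ => fun _ => ∅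
  | proj y P => fun r => if r ∈ P.rels then y ∪ P.scope r else ∅
  | join _ P => fun r => Finset.univ.biUnion fun S => (P S).scope r

theorem mem_rels_join {parts : Finset (Finset Rel)} {P : {S // S ∈ parts} → Plan Rel V} {r : Rel} :
    r ∈ (join parts P).rels ↔ ∃ S, r ∈ (P S).rels := by
  simp [rels]

theorem scope_eq_empty {P : Plan Rel V} {r : Rel} (hr : r ∉ P.rels) : P.scope r = ∅ := by
  induction P with
  | atom s => rfl
  | proj y P ih => exact if_neg hr
  | join parts P ih =>
    refine Finset.subset_empty.1 (Finset.biUnion_subset.2 fun S _ => ?_)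
    rw [ih S fun h => hr (mem_rels_join.2 ⟨S, h⟩)]

theorem mem_rels_of_mem_scope {P : Plan Rel V} {r : Rel} {x : V} (hx : x ∈ P.scope r) :
    r ∈ P.rels := by
  by_contra hr
  simp [scope_eq_empty hr] at hx

theorem projCount_pos_of_mem_scope {P : Plan Rel V} {r : Rel} {x : V} (hx : x ∈ P.scope r) :
    0 < P.projCount x := by
  induction P with
  | atom s => simp [scope] at hx
  | proj y P ih =>
    have hr : r ∈ P.rels := mem_rels_of_mem_scope (P := proj y P) hx
    simp only [scope, if_pos hr, Finset.mem_union] at hx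
    rw [projCount]
    rcases hx with hx | hx
    · simp [hx]
    · have := ih hx
      omega
  | join parts P ih =>
    simp only [scope, Finset.mem_biUnion, Finset.mem_univ, true_and] at hx
    obtain ⟨S, hS⟩ := hx
    exact Finset.sum_pos_iff.2 ⟨S, Finset.mem_univ _, ih S hS⟩

theorem projCount_le_join {parts : Finset (Finset Rel)} {P : {S // S ∈ parts} → Plan Rel V}
    (S : {S // S ∈ parts}) (x : V) : (P S).projCount x ≤ (join parts P).projCount x :=
  Finset.single_le_sum (f := fun S => (P S).projCount x) (fun _ _ => Nat.zero_le _)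
    (Finset.mem_univ S)

theorem eq_of_projCount_pos {parts : Finset (Finset Rel)} {P : {S // S ∈ parts} → Plan Rel V}
    {x : V} (h : (join parts P).projCount x ≤ 1) {S T : {S // S ∈ parts}}
    (hS : 0 < (P S).projCount x) (hT : 0 < (P T).projCount x) : S = T := by
  by_contra hne
  have h2 : ∑ U ∈ ({S, T} : Finset _), (P U).projCount x ≤ (join parts P).projCount x :=
    Finset.sum_le_sum_of_subset (Finset.subset_univ _)
  rw [Finset.sum_pair hne] at h2
  omega

theorem projCount_proj_of_mem {y : Finset V} {P : Plan Rel V} {x : V}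
    (h : (proj y P).projCount x ≤ 1) (hx : x ∈ y) : P.projCount x = 0 := by
  simp only [projCount, if_pos hx] at h
  omega

theorem projCount_le_proj (y : Finset V) (P : Plan Rel V) (x : V) :
    P.projCount x ≤ (proj y P).projCount x := Nat.le_add_left _ _

variable [∀ r, Fintype (attr r)] {q : Query attr V C}

theorem WellFormed.rels_nonempty {P : Plan Rel V} (h : P.WellFormed q) : P.rels.Nonempty := by
  induction P with
  | atom s => exact Finset.singleton_nonempty s
  | proj y P ih => exact ih h.2.2.2
  | join parts P ih =>
    obtain ⟨h2, -, -, hP⟩ := h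
    obtain ⟨S, hS⟩ := Finset.card_pos.1 (show 0 < parts.card by omega)
    obtain ⟨r, hr⟩ := ih ⟨S, hS⟩ (hP _).2
    exact ⟨r, mem_rels_join.2 ⟨_, hr⟩⟩

theorem WellFormed.eq_of_mem_rels {parts : Finset (Finset Rel)} {P : {S // S ∈ parts} → Plan Rel V}
    (h : (join parts P).WellFormed q) {S T : {S // S ∈ parts}} {r : Rel} (hS : r ∈ (P S).rels)
    (hT : r ∈ (P T).rels) : S = T := by
  obtain ⟨-, hrels, hdisj, -⟩ := h
  by_contra hne
  rw [hrels] at hS hT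
  exact Finset.disjoint_left.1 (hdisj S S.2 T T.2 fun h => hne (Subtype.ext h)) hS hT

theorem WellFormed.scope_join {parts : Finset (Finset Rel)} {P : {S // S ∈ parts} → Plan Rel V}
    (h : (join parts P).WellFormed q) {S : {S // S ∈ parts}} {r : Rel} (hS : r ∈ (P S).rels) :
    (join parts P).scope r = (P S).scope r := by
  ext x
  simp only [scope, Finset.mem_biUnion, Finset.mem_univ, true_and]
  refine ⟨?_, fun hx => ⟨S, hx⟩⟩
  rintro ⟨T, hx⟩
  rwa [h.eq_of_mem_rels hS (mem_rels_of_mem_scope hx)]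

theorem hvars_subset (P : Plan Rel V) : P.hvars q ⊆ P.rels.biUnion q.varsOf := by
  induction P with
  | atom s => simp [hvars, rels]
  | proj y P ih => exact Finset.sdiff_subset.trans ih
  | join parts P ih =>
    refine Finset.biUnion_subset.2 fun S _ => (ih S).trans ?_
    exact Finset.biUnion_subset_biUnion_of_subset_left _ fun r hr => mem_rels_join.2 ⟨S, hr⟩

theorem varsOf_subset {P : Plan Rel V} {r : Rel} (hr : r ∈ P.rels) :
    q.varsOf r ⊆ P.hvars q ∪ P.scope r := by
  induction P with
  | atom s =>
    rw [rels, Finset.mem_singleton] at hr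
    subst hr
    exact Finset.subset_union_left
  | proj y P ih =>
    intro x hx
    have := ih hr hx
    have hr' : r ∈ P.rels := hr
    simp only [hvars, scope, if_pos hr', Finset.mem_union, Finset.mem_sdiff] at this ⊢
    tauto
  | join parts P ih =>
    obtain ⟨S, hS⟩ := mem_rels_join.1 hr
    intro x hx
    have := ih S hS hx
    simp only [hvars, scope, Finset.mem_union, Finset.mem_biUnion, Finset.mem_univ,
      true_and] at this ⊢
    exact this.imp (fun h => ⟨S, h⟩) fun h => ⟨S, h⟩

theorem WellFormed.exists_mem_varsOf {P : Plan Rel V} (h : P.WellFormed q) {x : V}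
    (hx : 0 < P.projCount x) : ∃ r ∈ P.rels, x ∈ q.varsOf r := by
  induction P with
  | atom s => simp [projCount] at hx
  | proj y P ih =>
    by_cases hxy : x ∈ y
    · exact Finset.mem_biUnion.1 (hvars_subset P (h.2.1 hxy))
    · rw [projCount, if_neg hxy, zero_add] at hx
      exact ih h.2.2.2 hx
  | join parts P ih =>
    obtain ⟨S, -, hS⟩ := Finset.sum_pos_iff.1 (show 0 < ∑ S, (P S).projCount x from hx)
    obtain ⟨r, hr, hxr⟩ := ih S (h.2.2.2 S).2 hS
    exact ⟨r, mem_rels_join.2 ⟨S, hr⟩, hxr⟩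

/-- Well-formed plans in which no variable is projected away twice or both projected away and kept
as a head variable. -/
structure Proper (q : Query attr V C) (P : Plan Rel V) : Prop where
  wellFormed : P.WellFormed q
  projCount_le : ∀ x, P.projCount x ≤ 1
  projCount_hvars : ∀ x ∈ P.hvars q, P.projCount x = 0

theorem Proper.of_proj {y : Finset V} {P : Plan Rel V} (h : (proj y P).Proper q) : P.Proper q where
  wellFormed := h.wellFormed.2.2.2
  projCount_le x := (projCount_le_proj y P x).trans (h.projCount_le x)
  projCount_hvars x hx := by
    by_cases hxy : x ∈ y
    · exact projCount_proj_of_mem (h.projCount_le x) hxy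
    · exact Nat.eq_zero_of_le_zero <| (projCount_le_proj y P x).trans
        (h.projCount_hvars x (Finset.mem_sdiff.2 ⟨hx, hxy⟩)).le

theorem Proper.of_join {parts : Finset (Finset Rel)} {P : {S // S ∈ parts} → Plan Rel V}
    (h : (join parts P).Proper q) (S : {S // S ∈ parts}) : (P S).Proper q where
  wellFormed := (h.wellFormed.2.2.2 S).2
  projCount_le x := (projCount_le_join S x).trans (h.projCount_le x)
  projCount_hvars x hx := Nat.eq_zero_of_le_zero <| (projCount_le_join S x).trans
    (h.projCount_hvars x (Finset.mem_biUnion.2 ⟨S, Finset.mem_univ _, hx⟩)).le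

theorem dissociation_eq_empty {P : Plan Rel V} {r : Rel} (hr : r ∉ P.rels) :
    P.dissociation q r = ∅ := by
  induction P with
  | atom s => rfl
  | proj y P ih => exact ih hr
  | join parts P ih =>
    refine Finset.subset_empty.1 (Finset.biUnion_subset.2 fun S _ => ?_)
    rw [if_neg fun h => hr (mem_rels_join.2 ⟨S, h⟩)]

/-- On the way from the atom up to the root, joins enlarge the set of head variables and projections
move variables from the head into the scope. The union of the two sets therefore accumulates
everything the joins have added to the atom. -/
theorem Proper.dissociation_eq {P : Plan Rel V} (h : P.Proper q) {r : Rel} (hr : r ∈ P.rels) :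
    P.dissociation q r = ((P.scope r ∪ P.hvars q) \ q.varsOf r) ∩ q.evars := by
  induction P with
  | atom s =>
    rw [rels, Finset.mem_singleton] at hr
    subst hr
    simp [dissociation, scope, hvars]
  | proj y P ih =>
    have hr' : r ∈ P.rels := hr
    rw [dissociation, ih h.of_proj hr']
    have hy := h.wellFormed.2.1
    congr 2
    ext x
    have := @hy x
    simp only [scope, if_pos hr', hvars, Finset.mem_union, Finset.mem_sdiff]
    tauto
  | join parts P ih =>
    obtain ⟨S, hS⟩ := mem_rels_join.1 hr
    have h1 : (join parts P).dissociation q r =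
        (((join parts P).hvars q \ (P S).hvars q) ∩ q.evars) ∪ (P S).dissociation q r := by
      ext x
      simp only [dissociation, Finset.mem_biUnion, Finset.mem_univ, true_and]
      constructor
      · rintro ⟨T, hT⟩
        split_ifs at hT with hrT
        · rwa [h.wellFormed.eq_of_mem_rels hS hrT]
        · simp at hT
      · intro hx
        exact ⟨S, by rwa [if_pos hS]⟩
    rw [h1, ih S (h.of_join S) hS, h.wellFormed.scope_join hS]
    ext x
    have h2 : x ∈ (P S).hvars q → x ∈ (join parts P).hvars q := fun hx =>
      Finset.mem_biUnion.2 ⟨S, Finset.mem_univ _, hx⟩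
    -- A variable still in the head of the join was not projected away inside the operand. With
    -- `h7`, a variable contributed by a sibling operand is then not one of the atom's own.
    have h3 : x ∈ (join parts P).hvars q → x ∉ (P S).scope r := fun hx hx' => by
      have h4 := projCount_pos_of_mem_scope hx'
      have h5 := projCount_le_join (P := P) S x
      have h6 := h.projCount_hvars x hx
      omega
    have h7 := varsOf_subset (q := q) hS (x := x)
    simp only [Finset.mem_union, Finset.mem_inter, Finset.mem_sdiff] at h7 ⊢
    tauto

/-- The sets of atoms below the projections on two variables are nested or disjoint. -/
theorem Proper.laminar {P : Plan Rel V} (h : P.Proper q) (x y : V) :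
    (P.rels.filter fun r => x ∈ P.scope r) ⊆ (P.rels.filter fun r => y ∈ P.scope r) ∨
    Disjoint (P.rels.filter fun r => x ∈ P.scope r) (P.rels.filter fun r => y ∈ P.scope r) ∨
    (P.rels.filter fun r => y ∈ P.scope r) ⊆ (P.rels.filter fun r => x ∈ P.scope r) := by
  induction P with
  | atom s => left; simp [scope]
  | proj s P ih =>
    have hf : ∀ z, ((proj s P).rels.filter fun r => z ∈ (proj s P).scope r) =
        P.rels.filter fun r => z ∈ s ∨ z ∈ P.scope r := by
      intro z
      refine Finset.filter_congr fun r hr => ?_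
      have hr' : r ∈ P.rels := hr
      simp [scope, if_pos hr']
    rw [hf, hf]
    by_cases hx : x ∈ s
    · right; right
      simp [hx]
    by_cases hy : y ∈ s
    · left
      simp [hy]
    simpa [hx, hy] using ih h.of_proj
  | join parts P ih =>
    -- As a variable is projected away only once, all atoms below its projection lie in a single
    -- operand. Two variables thus either share an operand, where induction applies, or have
    -- disjoint sets of atoms.
    have key : ∀ z S, 0 < (P S).projCount z →
        ((join parts P).rels.filter fun r => z ∈ (join parts P).scope r) =
          (P S).rels.filter fun r => z ∈ (P S).scope r := by
      intro z S hz
      ext r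
      simp only [Finset.mem_filter]
      constructor
      · rintro ⟨hr, hzr⟩
        obtain ⟨T, hT⟩ := mem_rels_join.1 hr
        rw [h.wellFormed.scope_join hT] at hzr
        obtain rfl := eq_of_projCount_pos (h.projCount_le z) hz (projCount_pos_of_mem_scope hzr)
        exact ⟨hT, hzr⟩
      · rintro ⟨hr, hzr⟩
        exact ⟨mem_rels_join.2 ⟨S, hr⟩, by rwa [h.wellFormed.scope_join hr]⟩
    have hzero : ∀ z, (∀ S, ¬ 0 < (P S).projCount z) →
        ((join parts P).rels.filter fun r => z ∈ (join parts P).scope r) = ∅ := by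
      intro z hz
      refine Finset.filter_eq_empty_iff.2 fun r hr hzr => ?_
      obtain ⟨T, hT⟩ := mem_rels_join.1 hr
      rw [h.wellFormed.scope_join hT] at hzr
      exact hz T (projCount_pos_of_mem_scope hzr)
    by_cases hx : ∃ S, 0 < (P S).projCount x
    swap
    · left
      rw [hzero x (by simpa using hx)]
      exact Finset.empty_subset _
    by_cases hy : ∃ S, 0 < (P S).projCount y
    swap
    · right; right
      rw [hzero y (by simpa using hy)]
      exact Finset.empty_subset _
    obtain ⟨S, hS⟩ := hx
    obtain ⟨T, hT⟩ := hy
    rw [key x S hS, key y T hT]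
    by_cases hST : S = T
    · subst hST
      exact ih S (h.of_join S)
    · right; left
      refine Finset.disjoint_left.2 fun r hr hr' => hST ?_
      exact h.wellFormed.eq_of_mem_rels (Finset.mem_filter.1 hr).1 (Finset.mem_filter.1 hr').1

/-! ### A plan is determined by its scopes -/

/-- At a join, a variable above all atoms would have to be projected away in each of the at least
two nonempty operands. -/
theorem Proper.exists_notMem_scope {P : Plan Rel V} (h : P.Proper q) (hP : ¬ P.IsProj) (x : V) :
    ∃ r ∈ P.rels, x ∉ P.scope r := by
  cases P with
  | atom s => exact ⟨s, Finset.mem_singleton_self s, by simp [scope]⟩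
  | proj y P => exact absurd trivial hP
  | join parts P =>
    obtain ⟨S, hS, T, hT, hST⟩ := Finset.one_lt_card.1 h.wellFormed.1
    by_contra! hcon
    have hpos : ∀ U, 0 < (P U).projCount x := by
      intro U
      obtain ⟨r, hr⟩ := (h.of_join U).wellFormed.rels_nonempty
      have := hcon r (mem_rels_join.2 ⟨U, hr⟩)
      rw [h.wellFormed.scope_join hr] at this
      exact projCount_pos_of_mem_scope this
    exact hST (congrArg Subtype.val
      (eq_of_projCount_pos (h.projCount_le x) (hpos ⟨S, hS⟩) (hpos ⟨T, hT⟩)))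

/-- Reads the root projection off the scopes. This needs alternation: were the child again a
projection, its variables would be above all atoms too. -/
theorem Proper.mem_iff_of_proj {y : Finset V} {P : Plan Rel V} (h : (proj y P).Proper q) {x : V} :
    x ∈ y ↔ ∀ r ∈ P.rels, x ∈ (proj y P).scope r := by
  constructor
  · intro hx r hr
    simp [scope, hr, hx]
  · intro hx
    obtain ⟨r, hr, hxr⟩ := h.of_proj.exists_notMem_scope h.wellFormed.2.2.1 x
    have := hx r hr
    simp only [scope, if_pos hr, Finset.mem_union] at this
    tauto

theorem Proper.scope_of_proj {y : Finset V} {P : Plan Rel V} (h : (proj y P).Proper q) {r : Rel}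
    (hr : r ∈ P.rels) : P.scope r = (proj y P).scope r \ y := by
  ext x
  simp only [scope, if_pos hr, Finset.mem_sdiff, Finset.mem_union]
  refine ⟨fun hx => ⟨Or.inr hx, fun hxy => ?_⟩, by tauto⟩
  have := projCount_proj_of_mem (h.projCount_le x) hxy
  have := projCount_pos_of_mem_scope hx
  omega

/-- Reads the operands of a root join off the scopes. Joins do not nest, so an operand is a single
atom or a projection, and the nonempty projected set is shared by all its atoms. Across operands
nothing is shared, since each variable is projected away at most once. -/
theorem Proper.mem_part_iff {parts : Finset (Finset Rel)} {P : {S // S ∈ parts} → Plan Rel V}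
    (h : (join parts P).Proper q) {S : {S // S ∈ parts}} {r s : Rel} (hr : r ∈ S.1) :
    s ∈ S.1 ↔ s = r ∨ ∃ x, x ∈ (join parts P).scope r ∧ x ∈ (join parts P).scope s := by
  have hrels := h.wellFormed.2.1
  have hr' : r ∈ (P S).rels := by rwa [hrels S]
  rw [h.wellFormed.scope_join hr']
  constructor
  · intro hs
    have hs' : s ∈ (P S).rels := by rwa [hrels S]
    rw [h.wellFormed.scope_join hs']
    have hnj := (h.wellFormed.2.2.2 S).1
    have hW := (h.of_join S).wellFormed
    generalize P S = Q at *
    cases Q with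
    | atom t =>
      simp only [rels, Finset.mem_singleton] at hr' hs'
      left
      rw [hr', hs']
    | proj y Q =>
      obtain ⟨x, hx⟩ := hW.1
      have hr2 : r ∈ Q.rels := hr'
      have hs2 : s ∈ Q.rels := hs'
      right
      exact ⟨x, by simp [scope, hr2, hx], by simp [scope, hs2, hx]⟩
    | join _ _ => exact absurd trivial hnj
  · rintro (rfl | ⟨x, hx, hx'⟩)
    · exact hr
    · obtain ⟨T, hT⟩ := mem_rels_join.1 (mem_rels_of_mem_scope hx')
      rw [h.wellFormed.scope_join hT] at hx'
      obtain rfl := eq_of_projCount_pos (h.projCount_le x) (projCount_pos_of_mem_scope hx)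
        (projCount_pos_of_mem_scope hx')
      rwa [hrels S] at hT

theorem Proper.isProj_iff {P : Plan Rel V} (h : P.Proper q) :
    P.IsProj ↔ ∃ x, ∀ r ∈ P.rels, x ∈ P.scope r := by
  constructor
  · intro hP
    cases P with
    | proj y P =>
      obtain ⟨x, hx⟩ := h.wellFormed.1
      exact ⟨x, h.mem_iff_of_proj.1 hx⟩
    | atom _ => exact hP.elim
    | join _ _ => exact hP.elim
  · rintro ⟨x, hx⟩
    by_contra hP
    obtain ⟨r, hr, hxr⟩ := h.exists_notMem_scope hP x
    exact hxr (hx r hr)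

theorem WellFormed.one_lt_card_rels {parts : Finset (Finset Rel)}
    {P : {S // S ∈ parts} → Plan Rel V} (h : (join parts P).WellFormed q) :
    1 < (join parts P).rels.card := by
  obtain ⟨S, hS, T, hT, hST⟩ := Finset.one_lt_card.1 h.1
  obtain ⟨r, hr⟩ := (h.2.2.2 ⟨S, hS⟩).2.rels_nonempty
  obtain ⟨s, hs⟩ := (h.2.2.2 ⟨T, hT⟩).2.rels_nonempty
  refine Finset.one_lt_card.2 ⟨r, mem_rels_join.2 ⟨_, hr⟩, s, mem_rels_join.2 ⟨_, hs⟩, ?_⟩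
  rintro rfl
  exact hST (congrArg Subtype.val (h.eq_of_mem_rels hr hs))

theorem Proper.parts_subset {parts parts' : Finset (Finset Rel)}
    {P : {S // S ∈ parts} → Plan Rel V} {P' : {S // S ∈ parts'} → Plan Rel V}
    (h : (join parts P).Proper q) (h' : (join parts' P').Proper q)
    (hrels : (join parts P).rels = (join parts' P').rels)
    (hscope : (join parts P).scope = (join parts' P').scope) : parts ⊆ parts' := by
  intro S hS
  obtain ⟨r, hr⟩ := (h.of_join ⟨S, hS⟩).wellFormed.rels_nonempty
  have hr' : r ∈ (join parts' P').rels := hrels ▸ mem_rels_join.2 ⟨_, hr⟩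
  obtain ⟨T, hT⟩ := mem_rels_join.1 hr'
  rw [h.wellFormed.2.1] at hr
  rw [h'.wellFormed.2.1] at hT
  have : S = T.1 := by
    ext s
    rw [h.mem_part_iff (S := ⟨S, hS⟩) hr, h'.mem_part_iff hT, hscope]
  rw [this]
  exact T.2

/-- Top-down reconstruction: the relations and scopes reveal the kind of the root operator, then its
projected set or its partition, then the scopes of the children. -/
theorem Proper.eq_of_scope_eq {P P' : Plan Rel V} (h : P.Proper q) (h' : P'.Proper q)
    (hrels : P.rels = P'.rels) (hscope : P.scope = P'.scope) : P = P' := by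
  induction P generalizing P' with
  | atom r =>
    cases P' with
    | atom s =>
      simp only [rels, Finset.singleton_inj] at hrels
      rw [hrels]
    | proj y Q =>
      have := h.isProj_iff.2 (hrels ▸ hscope ▸ h'.isProj_iff.1 trivial)
      exact this.elim
    | join parts Q =>
      have := h'.wellFormed.one_lt_card_rels
      rw [← hrels] at this
      simp [rels] at this
  | proj y Q ih =>
    have hP' : P'.IsProj := h'.isProj_iff.2 (hrels ▸ hscope ▸ h.isProj_iff.1 trivial)
    cases P' with
    | atom _ => exact hP'.elim
    | join _ _ => exact hP'.elim
    | proj y' Q' =>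
      have hrels' : Q.rels = Q'.rels := hrels
      have hy : y = y' := by
        ext x
        rw [h.mem_iff_of_proj, h'.mem_iff_of_proj, hscope, hrels']
      subst hy
      rw [ih h.of_proj h'.of_proj hrels']
      funext r
      by_cases hr : r ∈ Q.rels
      · rw [h.scope_of_proj hr, h'.scope_of_proj (hrels' ▸ hr), hscope]
      · rw [scope_eq_empty hr, scope_eq_empty (hrels' ▸ hr)]
  | join parts Q ih =>
    cases P' with
    | atom s =>
      have := h.wellFormed.one_lt_card_rels
      rw [hrels] at this
      simp [rels] at this
    | proj y Q' =>
      have := h.isProj_iff.2 (hrels ▸ hscope ▸ h'.isProj_iff.1 trivial)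
      exact this.elim
    | join parts' Q' =>
      have hparts : parts = parts' := (h.parts_subset h' hrels hscope).antisymm
        (h'.parts_subset h hrels.symm hscope.symm)
      subst hparts
      congr 1
      funext S
      have hrels' : (Q S).rels = (Q' S).rels := by
        rw [h.wellFormed.2.1, h'.wellFormed.2.1]
      refine ih S (h.of_join S) (h'.of_join S) hrels' ?_
      funext r
      by_cases hr : r ∈ (Q S).rels
      · rw [← h.wellFormed.scope_join hr, ← h'.wellFormed.scope_join (hrels' ▸ hr), hscope]
      · rw [scope_eq_empty hr, scope_eq_empty (hrels' ▸ hr)]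

/-! ### Plans for a query -/

theorem IsPlanFor.proper {P : Plan Rel V} (h : P.IsPlanFor q) : P.Proper q where
  wellFormed := h.1
  projCount_le := h.2.2.2.1
  projCount_hvars x hx := h.2.2.2.2 x (h.2.2.1 ▸ hx)

theorem IsPlanFor.mem_evars {P : Plan Rel V} (h : P.IsPlanFor q) {x : V}
    (hx : 0 < P.projCount x) : x ∈ q.evars := by
  obtain ⟨r, hr, hxr⟩ := h.1.exists_mem_varsOf hx
  refine Finset.mem_sdiff.2 ⟨Finset.mem_biUnion.2 ⟨r, h.2.1 ▸ hr, hxr⟩, fun hxh => ?_⟩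
  have := h.2.2.2.2 x hxh
  omega

theorem IsPlanFor.scope_subset {P : Plan Rel V} (h : P.IsPlanFor q) (r : Rel) :
    P.scope r ⊆ q.evars := fun _ hx => h.mem_evars (projCount_pos_of_mem_scope hx)

theorem IsPlanFor.dissociation_eq {P : Plan Rel V} (h : P.IsPlanFor q) (r : Rel) :
    P.dissociation q r = P.scope r \ q.varsOf r := by
  by_cases hr : r ∈ P.rels
  · rw [h.proper.dissociation_eq hr, h.2.2.1]
    ext x
    have : x ∈ P.scope r → x ∈ q.evars := fun hx => h.scope_subset r hx
    have h2 : x ∈ q.evars → x ∉ q.head := fun hx => (Finset.mem_sdiff.1 hx).2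
    simp only [Finset.mem_union, Finset.mem_inter, Finset.mem_sdiff]
    tauto
  · rw [dissociation_eq_empty hr, scope_eq_empty hr, Finset.empty_sdiff]

theorem IsPlanFor.scope_eq {P : Plan Rel V} (h : P.IsPlanFor q) {r : Rel} (hr : r ∈ q.rels) :
    P.scope r = (q.varsOf r ∪ P.dissociation q r) \ q.head := by
  rw [h.dissociation_eq]
  ext x
  have h1 := @varsOf_subset _ _ _ _ _ q P r (h.2.1 ▸ hr) x
  have h2 : x ∈ P.scope r → x ∉ q.head := fun hx =>
    (Finset.mem_sdiff.1 (h.scope_subset r hx)).2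
  rw [h.2.2.1] at h1
  simp only [Finset.mem_union, Finset.mem_sdiff] at h1 ⊢
  tauto

theorem IsPlanFor.eq_of_dissociation_eq {P P' : Plan Rel V} (h : P.IsPlanFor q)
    (h' : P'.IsPlanFor q) (hd : P.dissociation q = P'.dissociation q) : P = P' := by
  refine h.proper.eq_of_scope_eq h'.proper (h.2.1.trans h'.2.1.symm) ?_
  funext r
  by_cases hr : r ∈ q.rels
  · rw [h.scope_eq hr, h'.scope_eq hr, hd]
  · rw [scope_eq_empty (h.2.1.symm ▸ hr), scope_eq_empty (h'.2.1.symm ▸ hr)]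

end Plan

/-! ### Dissociated queries -/

section

variable [∀ r, Fintype (attr r)] {q : Query attr V C}

theorem Query.mem_varsOf {r : Rel} {x : V} :
    x ∈ q.varsOf r ↔ ∃ i, q.args r i = Sum.inl x := by
  simp only [varsOf, Finset.mem_biUnion, Finset.mem_univ, true_and]
  refine exists_congr fun i => ?_
  cases q.args r i <;> simp [eq_comm]

theorem Query.varsOf_dissociate (Δ : Rel → Finset V) (r : Rel) :
    (q.dissociate Δ).varsOf r = q.varsOf r ∪ Δ r := by
  ext x
  rw [Finset.mem_union, Query.mem_varsOf, Query.mem_varsOf]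
  simp [dissociate]

theorem Query.IsDissociation.vars_dissociate {Δ : Rel → Finset V} (h : q.IsDissociation Δ) :
    (q.dissociate Δ).vars = q.vars := by
  ext x
  have h1 : x ∈ (q.dissociate Δ).vars ↔ ∃ r ∈ q.rels, x ∈ q.varsOf r ∪ Δ r := by
    rw [vars, Finset.mem_biUnion]
    exact exists_congr fun r => and_congr Iff.rfl (by rw [varsOf_dissociate])
  have h2 : x ∈ q.vars ↔ ∃ r ∈ q.rels, x ∈ q.varsOf r := Finset.mem_biUnion
  rw [h1]
  constructor
  · rintro ⟨r, hr, hx⟩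
    rcases Finset.mem_union.1 hx with hx | hx
    · exact h2.2 ⟨r, hr, hx⟩
    · exact (Finset.mem_sdiff.1 (h.1 r hr hx)).1
  · intro hx
    obtain ⟨r, hr, hx⟩ := h2.1 hx
    exact ⟨r, hr, Finset.mem_union_left _ hx⟩

theorem Plan.IsPlanFor.isSafeDissociation {P : Plan Rel V} (h : P.IsPlanFor q) :
    q.IsSafeDissociation (P.dissociation q) := by
  have hd : q.IsDissociation (P.dissociation q) := by
    refine ⟨fun r _ => ?_, fun r hr => Plan.dissociation_eq_empty (h.2.1.symm ▸ hr)⟩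
    rw [h.dissociation_eq]
    exact Finset.sdiff_subset_sdiff ((h.scope_subset r).trans Finset.sdiff_subset) subset_rfl
  refine ⟨hd, fun x hx y hy => ?_⟩
  -- After dissociation, an existential variable occurs exactly in the atoms below its projection,
  -- so laminarity of scopes is the hierarchy condition.
  have key : ∀ z ∈ (q.dissociate (P.dissociation q)).evars,
      (q.dissociate (P.dissociation q)).sg z = P.rels.filter fun r => z ∈ P.scope r := by
    intro z hz
    have hz' : z ∉ q.head := (Finset.mem_sdiff.1 hz).2
    rw [h.2.1]
    refine Finset.filter_congr fun r hr => ?_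
    rw [Query.varsOf_dissociate, h.scope_eq hr, Finset.mem_sdiff]
    tauto
  rw [key x hx, key y hy]
  exact h.proper.laminar x y

end

section

variable [∀ r, Fintype (attr r)] {q : Query attr V C}

/-! ### Components and top sets -/

namespace Query

theorem mem_vars {x : V} : x ∈ q.vars ↔ ∃ r ∈ q.rels, x ∈ q.varsOf r := Finset.mem_biUnion

theorem mem_evars {x : V} : x ∈ q.evars ↔ x ∈ q.vars ∧ x ∉ q.head := Finset.mem_sdiff

theorem mem_evars_addHead {y : Finset V} {x : V} :
    x ∈ (q.addHead y).evars ↔ x ∈ q.evars ∧ x ∉ y := by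
  have h : x ∈ (q.addHead y).evars ↔ x ∈ q.vars ∧ x ∉ q.head ∪ y := Finset.mem_sdiff
  rw [h, mem_evars, Finset.mem_union]
  tauto

theorem mem_evars_restrict {S : Finset Rel} {x : V} :
    x ∈ (q.restrict S).evars ↔ (∃ r ∈ S, x ∈ q.varsOf r) ∧ x ∉ q.head := by
  have h : x ∈ (q.restrict S).evars ↔
      x ∈ S.biUnion q.varsOf ∧ x ∉ q.head ∩ S.biUnion q.varsOf := Finset.mem_sdiff
  rw [h, Finset.mem_inter, Finset.mem_biUnion, not_and]
  exact and_congr_right fun h => ⟨fun h' hh => h' hh h, fun h' hh => absurd hh h'⟩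

theorem subset_of_mem_components {S : Finset Rel} (hS : S ∈ q.components) : S ⊆ q.rels := by
  obtain ⟨r, -, rfl⟩ := Finset.mem_image.1 hS
  exact Finset.filter_subset _ _

theorem nonempty_of_mem_components {S : Finset Rel} (hS : S ∈ q.components) : S.Nonempty := by
  obtain ⟨r, hr, rfl⟩ := Finset.mem_image.1 hS
  exact ⟨r, Finset.mem_filter.2 ⟨hr, Relation.ReflTransGen.refl⟩⟩

theorem mem_component_iff {S : Finset Rel} (hS : S ∈ q.components) {r s : Rel} (hr : r ∈ S) :
    s ∈ S ↔ s ∈ q.rels ∧ q.Linked r s := by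
  obtain ⟨t, ht, rfl⟩ := Finset.mem_image.1 hS
  rw [Finset.mem_filter] at hr ⊢
  exact and_congr_right fun _ => ⟨hr.2.symm.trans, hr.2.trans⟩

theorem exists_component {r : Rel} (hr : r ∈ q.rels) : ∃ S ∈ q.components, r ∈ S :=
  ⟨_, Finset.mem_image_of_mem _ hr, Finset.mem_filter.2 ⟨hr, Relation.ReflTransGen.refl⟩⟩

theorem eq_of_mem_components {S T : Finset Rel} (hS : S ∈ q.components) (hT : T ∈ q.components)
    {r s : Rel} (hr : r ∈ S) (hs : s ∈ T) (hrs : q.Linked r s) : S = T := by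
  ext t
  rw [mem_component_iff hS hr, mem_component_iff hT hs]
  exact and_congr_right fun _ => ⟨hrs.symm.trans, hrs.trans⟩

theorem eq_of_mem_evars_restrict {S T : Finset Rel} (hS : S ∈ q.components)
    (hT : T ∈ q.components) {x : V} (hx : x ∈ (q.restrict S).evars)
    (hx' : x ∈ (q.restrict T).evars) : S = T := by
  obtain ⟨⟨r, hr, hxr⟩, hh⟩ := mem_evars_restrict.1 hx
  obtain ⟨⟨s, hs, hxs⟩, -⟩ := mem_evars_restrict.1 hx'
  have hr' := subset_of_mem_components hS hr
  refine eq_of_mem_components hS hT hr hs (Relation.ReflTransGen.single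
    ⟨hr', subset_of_mem_components hT hs, x, ?_, hxr, hxs⟩)
  exact mem_evars.2 ⟨mem_vars.2 ⟨r, hr', hxr⟩, hh⟩

theorem connected_restrict {S : Finset Rel} (hS : S ∈ q.components) :
    (q.restrict S).Connected := by
  intro r hr s hs
  have hr' : r ∈ S := hr
  have hrs := ((mem_component_iff hS hr').1 hs).2
  clear hs
  induction hrs with
  | refl => exact Relation.ReflTransGen.refl
  | tail hab hbc ih =>
    rename_i b c
    obtain ⟨hb, hc, x, hx, hxb, hxc⟩ := hbc
    have hbS : b ∈ S := (mem_component_iff hS hr').2 ⟨hb, hab⟩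
    have hcS : c ∈ S := (mem_component_iff hS hr').2
      ⟨hc, hab.tail ⟨hb, hc, x, hx, hxb, hxc⟩⟩
    refine ih.tail ⟨hbS, hcS, x, ?_, hxb, hxc⟩
    exact mem_evars_restrict.2 ⟨⟨b, hbS, hxb⟩, (mem_evars.1 hx).2⟩

theorem one_lt_card_components (hq : ¬ q.Connected) : 1 < q.components.card := by
  simp only [Connected, not_forall] at hq
  obtain ⟨r, hr, s, hs, hrs⟩ := hq
  obtain ⟨S, hS, hrS⟩ := exists_component hr
  obtain ⟨T, hT, hsT⟩ := exists_component hs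
  refine Finset.one_lt_card.2 ⟨S, hS, T, hT, ?_⟩
  rintro rfl
  exact hrs ((mem_component_iff hS hrS).1 hsT).2

theorem mem_topSets {y : Finset V} :
    y ∈ q.topSets ↔ y ⊆ q.evars ∧ ¬ (q.addHead y).Connected ∧
      ∀ y', y' ⊂ y → (q.addHead y').Connected := by
  rw [topSets, Finset.mem_filter, Finset.mem_powerset]

theorem eq_of_subset_of_mem_topSets {y y' : Finset V} (hy : y ∈ q.topSets)
    (hy' : y' ∈ q.topSets) (h : y' ⊆ y) : y' = y := by
  by_contra hne
  exact (mem_topSets.1 hy').2.1 ((mem_topSets.1 hy).2.2 y' (h.ssubset_of_ne hne))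

theorem exists_topSet_subset {Y : Finset V} (hY : Y ⊆ q.evars)
    (hd : ¬ (q.addHead Y).Connected) : ∃ y ∈ q.topSets, y ⊆ Y := by
  obtain ⟨y, hyY, hy⟩ := exists_minimal_le_of_wellFoundedLT
    (fun y => y ⊆ q.evars ∧ ¬ (q.addHead y).Connected) Y ⟨hY, hd⟩
  refine ⟨y, mem_topSets.2 ⟨hy.prop.1, hy.prop.2, fun y' hy' => ?_⟩, hyY⟩
  by_contra hcon
  exact hy'.2 (hy.le_of_le ⟨hy'.1.trans hy.prop.1, hcon⟩ hy'.1)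

theorem nonempty_of_mem_topSets (hq : q.Connected) {y : Finset V} (hy : y ∈ q.topSets) :
    y.Nonempty := by
  rw [Finset.nonempty_iff_ne_empty]
  rintro rfl
  refine (mem_topSets.1 hy).2.1 ?_
  rwa [show q.addHead ∅ = q by simp [addHead]]

end Query

/-! ### The algorithm returns plans -/

theorem Plan.hvars_congr {q q' : Query attr V C} (h : q.args = q'.args) (P : Plan Rel V) :
    P.hvars q = P.hvars q' := by
  induction P with
  | atom r => simp [hvars, Query.varsOf, h]
  | proj y P ih => simp [hvars, ih]
  | join parts P ih => simp [hvars, ih]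

theorem Plan.wellFormed_congr {q q' : Query attr V C} (h : q.args = q'.args) (P : Plan Rel V) :
    P.WellFormed q ↔ P.WellFormed q' := by
  induction P with
  | atom r => simp [WellFormed]
  | proj y P ih => simp [WellFormed, ih, hvars_congr h]
  | join parts P ih => simp [WellFormed, ih]

theorem mem_MP_of_card_eq_one {P : Plan Rel V} (h : q.rels.card = 1) :
    P ∈ MP q ↔ ∃ r, q.rels = {r} ∧
      P = if q.evars = ∅ then Plan.atom r else Plan.proj q.evars (Plan.atom r) := by
  obtain ⟨r, hr⟩ := Finset.card_eq_one.1 h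
  rw [MP, if_pos h, hr]
  simp [eq_comm]

theorem mem_MP_of_connected {P : Plan Rel V} (h : q.rels.card ≠ 1) (hq : q.Connected) :
    P ∈ MP q ↔ ∃ y ∈ q.topSets, ∃ P' ∈ MP (q.addHead y), P = Plan.proj y P' := by
  rw [MP, if_neg h, dif_pos hq]
  simp [eq_comm]

theorem mem_MP_of_not_connected {P : Plan Rel V} (h : q.rels.card ≠ 1) (hq : ¬ q.Connected) :
    P ∈ MP q ↔ ∃ f : {S // S ∈ q.components} → Plan Rel V,
      (∀ S, f S ∈ MP (q.restrict S.1)) ∧ P = Plan.join q.components f := by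
  rw [MP, if_neg h, dif_neg hq]
  simp [eq_comm]

/-- Induction along the recursive calls of the algorithm. -/
theorem MP_induction {motive : (q : Query attr V C) → q.head ⊆ q.vars → Prop}
    (single : ∀ q hq, q.rels.card = 1 → motive q hq)
    (connected : ∀ q hq, q.rels.card ≠ 1 → q.Connected →
      (∀ y ∈ q.topSets, ∀ h, motive (q.addHead y) h) → motive q hq)
    (disconnected : ∀ q hq, q.rels.card ≠ 1 → ¬ q.Connected →
      (∀ S ∈ q.components, ∀ h, motive (q.restrict S) h) → motive q hq)
    (q : Query attr V C) (hq : q.head ⊆ q.vars) : motive q hq := by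
  induction q using MP.induct with
  | case1 q h => exact single q hq h
  | case2 q h hc ih => exact connected q hq h hc fun y hy => ih ⟨y, hy⟩
  | case3 q h hc ih => exact disconnected q hq h hc fun S hS => ih ⟨S, hS⟩

theorem Query.head_addHead_subset (hq : q.head ⊆ q.vars) {y : Finset V} (hy : y ∈ q.topSets) :
    (q.addHead y).head ⊆ (q.addHead y).vars :=
  Finset.union_subset hq ((mem_topSets.1 hy).1.trans Finset.sdiff_subset)

theorem Query.head_restrict_subset (S : Finset Rel) :
    (q.restrict S).head ⊆ (q.restrict S).vars := Finset.inter_subset_right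

/-- After a projection the recursive call falls into the join case. This is one half of the
alternation of operators; `not_isJoin_of_mem_MP` is the other, since components are connected. -/
theorem not_connected_addHead {y : Finset V} (hy : y ∈ q.topSets) :
    ¬ (q.addHead y).Connected ∧ (q.addHead y).rels.card ≠ 1 := by
  have hd := (Query.mem_topSets.1 hy).2.1
  refine ⟨hd, fun h1 => hd ?_⟩
  obtain ⟨r, hr⟩ := Finset.card_eq_one.1 h1
  intro a ha b hb
  rw [hr, Finset.mem_singleton] at ha hb
  subst ha hb
  exact Relation.ReflTransGen.refl

theorem not_isProj_of_mem_MP {P : Plan Rel V} {y : Finset V} (hy : y ∈ q.topSets)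
    (hP : P ∈ MP (q.addHead y)) : ¬ P.IsProj := by
  obtain ⟨hd, hc⟩ := not_connected_addHead hy
  obtain ⟨f, -, rfl⟩ := (mem_MP_of_not_connected hc hd).1 hP
  exact id

theorem not_isJoin_of_mem_MP {P : Plan Rel V} (hq : q.Connected) (hP : P ∈ MP q) :
    ¬ P.IsJoin := by
  by_cases h : q.rels.card = 1
  · obtain ⟨r, -, rfl⟩ := (mem_MP_of_card_eq_one h).1 hP
    split_ifs <;> exact id
  · obtain ⟨y, -, P', -, rfl⟩ := (mem_MP_of_connected h hq).1 hP
    exact id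

theorem isPlanFor_of_mem_MP (hq : q.head ⊆ q.vars) : ∀ P ∈ MP q, P.IsPlanFor q := by
  induction q, hq using MP_induction with
  | single q hq h =>
    intro P hP
    obtain ⟨r, hr, rfl⟩ := (mem_MP_of_card_eq_one h).1 hP
    have hvars : q.vars = q.varsOf r := by simp [Query.vars, hr]
    have hev : q.evars = q.varsOf r \ q.head := by rw [Query.evars, hvars]
    rw [hvars] at hq
    split_ifs with he
    · refine ⟨trivial, by simp [Plan.rels, hr], ?_, fun x => Nat.zero_le _, fun x _ => rfl⟩
      refine (Finset.sdiff_eq_empty_iff_subset.1 (hev ▸ he)).antisymm hq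
    · refine ⟨⟨Finset.nonempty_iff_ne_empty.2 he, ?_, id, trivial⟩, by simp [Plan.rels, hr], ?_,
        fun x => ?_, fun x hx => ?_⟩
      · rw [hev]
        exact Finset.sdiff_subset
      · rw [Plan.hvars, Plan.hvars, hev, Finset.sdiff_sdiff_eq_self hq]
      · simp only [Plan.projCount]
        split_ifs <;> omega
      · have : x ∉ q.evars := fun h => (Query.mem_evars.1 h).2 hx
        simp [Plan.projCount, this]
  | connected q hq h hc ih =>
    intro P hP
    obtain ⟨y, hy, P, hPy, rfl⟩ := (mem_MP_of_connected h hc).1 hP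
    obtain ⟨hW, hrels, hhv, hcount, hhead⟩ := ih y hy (Query.head_addHead_subset hq hy) P hPy
    have hye := (Query.mem_topSets.1 hy).1
    have hhv' : P.hvars q = q.head ∪ y :=
      (Plan.hvars_congr (q := q) (q' := q.addHead y) rfl P).trans hhv
    have hdisj : Disjoint q.head y := Finset.disjoint_right.2 fun x hx =>
      (Query.mem_evars.1 (hye hx)).2
    refine ⟨⟨Query.nonempty_of_mem_topSets hc hy, ?_, not_isProj_of_mem_MP hy hPy,
      (Plan.wellFormed_congr (q := q.addHead y) (q' := q) rfl P).1 hW⟩, hrels, ?_, fun x => ?_,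
      fun x hx => ?_⟩
    · rw [hhv']
      exact Finset.subset_union_right
    · rw [Plan.hvars, hhv', Finset.union_sdiff_cancel_right hdisj]
    · rw [Plan.projCount]
      split_ifs with hx
      · rw [hhead x (Finset.mem_union_right _ hx)]
      · rw [zero_add]
        exact hcount x
    · rw [Plan.projCount, if_neg (Finset.disjoint_left.1 hdisj hx), zero_add]
      exact hhead x (Finset.mem_union_left _ hx)
  | disconnected q hq h hc ih =>
    intro P hP
    obtain ⟨f, hf, rfl⟩ := (mem_MP_of_not_connected h hc).1 hP
    have hplan : ∀ S, (f S).IsPlanFor (q.restrict S.1) := fun S =>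
      ih S.1 S.2 (Query.head_restrict_subset S.1) (f S) (hf S)
    refine ⟨⟨Query.one_lt_card_components hc, fun S => (hplan S).2.1, fun S hS T hT hST => ?_,
      fun S => ⟨not_isJoin_of_mem_MP (Query.connected_restrict S.2) (hf S),
        (Plan.wellFormed_congr (q := q.restrict S.1) (q' := q) rfl (f S)).1 (hplan S).1⟩⟩, ?_, ?_,
        fun x => ?_,
        fun x hx => ?_⟩
    · exact Finset.disjoint_left.2 fun r hr hr' => hST
        (Query.eq_of_mem_components hS hT hr hr' Relation.ReflTransGen.refl)
    · ext r
      rw [Plan.mem_rels_join]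
      constructor
      · rintro ⟨S, hS⟩
        rw [(hplan S).2.1] at hS
        exact Query.subset_of_mem_components S.2 hS
      · intro hr
        obtain ⟨S, hS, hrS⟩ := Query.exists_component hr
        refine ⟨⟨S, hS⟩, ?_⟩
        rw [(hplan _).2.1]
        exact hrS
    · ext x
      have hx : ∀ S, x ∈ (f S).hvars q ↔ x ∈ q.head ∧ ∃ r ∈ S.1, x ∈ q.varsOf r := by
        intro S
        rw [Plan.hvars_congr (q := q) (q' := q.restrict S.1) rfl, (hplan S).2.2.1]
        simp [Query.restrict]
      simp only [Plan.hvars, Finset.mem_biUnion, Finset.mem_univ, true_and, hx]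
      constructor
      · rintro ⟨S, hS, -⟩
        exact hS
      · intro hxh
        obtain ⟨r, hr, hxr⟩ := Query.mem_vars.1 (hq hxh)
        obtain ⟨S, hS, hrS⟩ := Query.exists_component hr
        exact ⟨⟨S, hS⟩, hxh, r, hrS, hxr⟩
    -- Only existential variables are projected away, and no existential variable occurs in two
    -- components. So at most one summand is nonzero.
    · by_cases hx : ∃ S, 0 < (f S).projCount x
      · obtain ⟨S, hS⟩ := hx
        rw [Plan.projCount, Finset.sum_eq_single S]
        · exact (hplan S).2.2.2.1 x
        · intro T _ hTS
          by_contra hT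
          exact hTS (Subtype.ext (Query.eq_of_mem_evars_restrict T.2 S.2
            ((hplan T).mem_evars (Nat.pos_of_ne_zero hT)) ((hplan S).mem_evars hS)))
        · simp
      · rw [Plan.projCount, Finset.sum_eq_zero]
        · exact zero_le_one
        · intro S _
          by_contra hS
          exact hx ⟨S, Nat.pos_of_ne_zero hS⟩
    · refine Finset.sum_eq_zero fun S _ => ?_
      by_contra hS
      exact (Query.mem_evars_restrict.1 ((hplan S).mem_evars (Nat.pos_of_ne_zero hS))).2 hx

/-! ### The plans returned are incomparable -/

/-- The root projection consists of the variables lying in every scope, so comparable plans have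
nested top sets at the root. Minimality makes these equal, and the comparison descends. At a join
both plans have the same operands, the components. -/
theorem eq_of_mem_MP_of_scope_subset (hq : q.head ⊆ q.vars) :
    ∀ P ∈ MP q, ∀ P' ∈ MP q, (∀ r ∈ q.rels, P'.scope r ⊆ P.scope r) → P' = P := by
  induction q, hq using MP_induction with
  | single q hq h =>
    intro P hP P' hP' _
    obtain ⟨r, hr, rfl⟩ := (mem_MP_of_card_eq_one h).1 hP
    obtain ⟨r', hr', rfl⟩ := (mem_MP_of_card_eq_one h).1 hP'
    obtain rfl : r = r' := by simpa [hr] using hr'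
    rfl
  | connected q hq h hc ih =>
    intro P hP P' hP' hle
    have hplan := isPlanFor_of_mem_MP hq _ hP
    have hplan' := isPlanFor_of_mem_MP hq _ hP'
    obtain ⟨y, hy, P, hPy, rfl⟩ := (mem_MP_of_connected h hc).1 hP
    obtain ⟨y', hy', P', hPy', rfl⟩ := (mem_MP_of_connected h hc).1 hP'
    have hsub : y' ⊆ y := fun x hx => hplan.proper.mem_iff_of_proj.2 fun r hr =>
      hle r (hplan.2.1 ▸ hr) (hplan'.proper.mem_iff_of_proj.1 hx r (by
        have h1 : P.rels = q.rels := hplan.2.1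
        have h2 : P'.rels = q.rels := hplan'.2.1
        rwa [h2, ← h1]))
    obtain rfl := Query.eq_of_subset_of_mem_topSets hy hy' hsub
    rw [ih _ hy (Query.head_addHead_subset hq hy) P hPy P' hPy' fun r hr => ?_]
    have h1 : P.rels = q.rels := hplan.2.1
    have h2 : P'.rels = q.rels := hplan'.2.1
    rw [hplan.proper.scope_of_proj (h1 ▸ hr), hplan'.proper.scope_of_proj (h2 ▸ hr)]
    exact Finset.sdiff_subset_sdiff (hle r hr) subset_rfl
  | disconnected q hq h hc ih =>
    intro P hP P' hP' hle
    have hplan := isPlanFor_of_mem_MP hq _ hP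
    have hplan' := isPlanFor_of_mem_MP hq _ hP'
    obtain ⟨f, hf, rfl⟩ := (mem_MP_of_not_connected h hc).1 hP
    obtain ⟨f', hf', rfl⟩ := (mem_MP_of_not_connected h hc).1 hP'
    congr 1
    funext S
    refine ih S.1 S.2 (Query.head_restrict_subset S.1) _ (hf S) _ (hf' S) fun r hr => ?_
    have hr' : r ∈ S.1 := hr
    have h1 := hle r (Query.subset_of_mem_components S.2 hr')
    rwa [hplan.1.scope_join (S := S) (by rwa [hplan.1.2.1]),
      hplan'.1.scope_join (S := S) (by rwa [hplan'.1.2.1])] at h1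

/-! ### Every safe dissociation is above a plan returned -/

/-- `L` assigns to every atom existential variables, among them those of the atom, in such a way
that the sets of atoms to which two variables are assigned are nested or disjoint. -/
structure IsLabelling (q : Query attr V C) (L : Rel → Finset V) : Prop where
  varsOf_subset : ∀ r ∈ q.rels, q.varsOf r \ q.head ⊆ L r
  subset_evars : ∀ r ∈ q.rels, L r ⊆ q.evars
  laminar : ∀ x ∈ q.evars, ∀ y ∈ q.evars,
    (q.rels.filter fun r => x ∈ L r) ⊆ (q.rels.filter fun r => y ∈ L r) ∨
    Disjoint (q.rels.filter fun r => x ∈ L r) (q.rels.filter fun r => y ∈ L r) ∨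
    (q.rels.filter fun r => y ∈ L r) ⊆ (q.rels.filter fun r => x ∈ L r)

theorem Query.IsSafeDissociation.isLabelling {Δ : Rel → Finset V} (h : q.IsSafeDissociation Δ) :
    IsLabelling q fun r => (q.varsOf r ∪ Δ r) \ q.head where
  varsOf_subset r _ := Finset.sdiff_subset_sdiff Finset.subset_union_left subset_rfl
  subset_evars r hr := by
    refine Finset.sdiff_subset_sdiff (Finset.union_subset ?_ ?_) subset_rfl
    · exact Finset.subset_biUnion_of_mem q.varsOf hr
    · exact (h.1.1 r hr).trans Finset.sdiff_subset
  laminar x hx y hy := by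
    have key : ∀ z ∈ q.evars, (q.rels.filter fun r => z ∈ (q.varsOf r ∪ Δ r) \ q.head) =
        (q.dissociate Δ).sg z := by
      intro z hz
      refine Finset.filter_congr fun r hr => ?_
      rw [Query.varsOf_dissociate, Finset.mem_sdiff, and_iff_left (Query.mem_evars.1 hz).2]
    have hev : (q.dissociate Δ).evars = q.evars := by
      rw [Query.evars, h.1.vars_dissociate]
      rfl
    rw [key x hx, key y hy]
    exact h.2 x (hev ▸ hx) y (hev ▸ hy)

theorem IsLabelling.restrict {L : Rel → Finset V} (h : IsLabelling q L) {S : Finset Rel}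
    (hS : S ⊆ q.rels) : IsLabelling (q.restrict S) fun r => L r ∩ (q.restrict S).evars where
  varsOf_subset r hr := by
    have hr' : r ∈ S := hr
    intro x hx
    obtain ⟨hx, hxh⟩ := Finset.mem_sdiff.1 hx
    have hx' : x ∉ q.head := fun hh =>
      hxh (Finset.mem_inter.2 ⟨hh, Finset.mem_biUnion.2 ⟨r, hr', hx⟩⟩)
    exact Finset.mem_inter.2 ⟨h.varsOf_subset r (hS hr') (Finset.mem_sdiff.2 ⟨hx, hx'⟩),
      Query.mem_evars_restrict.2 ⟨⟨r, hr', hx⟩, hx'⟩⟩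
  subset_evars r _ := Finset.inter_subset_right
  laminar x hx y hy := by
    have key : ∀ z ∈ (q.restrict S).evars,
        ((q.restrict S).rels.filter fun r => z ∈ L r ∩ (q.restrict S).evars) =
          (q.rels.filter fun r => z ∈ L r) ∩ S := by
      intro z hz
      ext r
      have := @hS r
      simp only [Finset.mem_filter, Finset.mem_inter, hz]
      change r ∈ S ∧ _ ↔ _
      tauto
    have hev : ∀ z ∈ (q.restrict S).evars, z ∈ q.evars := by
      intro z hz
      obtain ⟨⟨r, hr, hzr⟩, hzh⟩ := Query.mem_evars_restrict.1 hz
      exact Query.mem_evars.2 ⟨Query.mem_vars.2 ⟨r, hS hr, hzr⟩, hzh⟩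
    rw [key x hx, key y hy]
    rcases h.laminar x (hev x hx) y (hev y hy) with h1 | h1 | h1
    · exact Or.inl (Finset.inter_subset_inter_right h1)
    · exact Or.inr (Or.inl (h1.mono Finset.inter_subset_left Finset.inter_subset_left))
    · exact Or.inr (Or.inr (Finset.inter_subset_inter_right h1))

theorem IsLabelling.addHead {L : Rel → Finset V} (h : IsLabelling q L) (y : Finset V) :
    IsLabelling (q.addHead y) fun r => L r \ y where
  varsOf_subset r hr := by
    intro x hx
    obtain ⟨hx, hxh⟩ := Finset.mem_sdiff.1 hx
    have hxh' : x ∉ q.head ∪ y := hxh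
    rw [Finset.mem_union, not_or] at hxh'
    exact Finset.mem_sdiff.2 ⟨h.varsOf_subset r hr (Finset.mem_sdiff.2 ⟨hx, hxh'.1⟩), hxh'.2⟩
  subset_evars r hr := by
    intro x hx
    obtain ⟨hx, hxy⟩ := Finset.mem_sdiff.1 hx
    exact Query.mem_evars_addHead.2 ⟨h.subset_evars r hr hx, hxy⟩
  laminar x hx y' hy' := by
    obtain ⟨hx, hxy⟩ := Query.mem_evars_addHead.1 hx
    obtain ⟨hy', hyy⟩ := Query.mem_evars_addHead.1 hy'
    simp only [Finset.mem_sdiff, hxy, hyy, not_false_eq_true, and_true]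
    exact h.laminar x hx y' hy'

/-- Among the variables not assigned to all atoms, take one whose set of atoms is largest. If the
query stayed connected, some atom in this set would share a remaining variable `z` with an atom
outside it. The set of `z` meets the chosen set and sticks out, so by laminarity it is strictly
larger, a contradiction. -/
theorem IsLabelling.not_connected {L : Rel → Finset V} (h : IsLabelling q L)
    (hcard : 1 < q.rels.card) :
    ¬ (q.addHead (q.evars.filter fun x => ∀ r ∈ q.rels, x ∈ L r)).Connected := by
  set Y := q.evars.filter fun x => ∀ r ∈ q.rels, x ∈ L r with hY
  intro hcon
  -- an edge leaving a set of atoms that is neither empty nor everything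
  have edge : ∀ T ⊆ q.rels, T.Nonempty → T ≠ q.rels →
      ∃ r ∈ T, ∃ s ∉ T, (q.addHead Y).Adj r s := by
    intro T hT hne hne'
    by_contra! hno
    obtain ⟨r, hr⟩ := hne
    refine hne' (hT.antisymm fun s hs => ?_)
    have hrs := hcon r (hT hr) s hs
    clear hs
    induction hrs with
    | refl => exact hr
    | tail _ hbc ih =>
      by_contra hc
      exact hno _ ih _ hc hbc
  have sg_nonempty : ∀ r s x, (q.addHead Y).Adj r s → x ∈ (q.addHead Y).evars → x ∈ q.varsOf r →
      r ∈ q.rels.filter fun r => x ∈ L r := by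
    intro r s x hrs hx hxr
    refine Finset.mem_filter.2 ⟨hrs.1, h.varsOf_subset r hrs.1 (Finset.mem_sdiff.2 ⟨hxr, ?_⟩)⟩
    exact (Query.mem_evars.1 (Query.mem_evars_addHead.1 hx).1).2
  -- Two distinct atoms are needed here: an edge leaving `{r₀}` provides a variable outside `Y`, so
  -- that the maximum below is over a nonempty set.
  obtain ⟨r₀, hr₀, s₀, hs₀, hne₀⟩ := Finset.one_lt_card.1 hcard
  obtain ⟨r₁, -, s₁, -, hadj⟩ := edge {r₀} (Finset.singleton_subset_iff.2 hr₀)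
    (Finset.singleton_nonempty _) (fun he => hne₀ (by
      rw [← he, Finset.mem_singleton] at hs₀
      exact hs₀.symm))
  obtain ⟨x₁, hx₁, hxr₁, -⟩ := hadj.2.2
  obtain ⟨x, hx, hmax⟩ := Finset.exists_max_image
    ((q.addHead Y).evars.filter fun x => (q.rels.filter fun r => x ∈ L r).Nonempty)
    (fun x => (q.rels.filter fun r => x ∈ L r).card)
    ⟨x₁, Finset.mem_filter.2 ⟨hx₁, r₁, sg_nonempty _ _ _ hadj hx₁ hxr₁⟩⟩
  obtain ⟨hxe, hxne⟩ := Finset.mem_filter.1 hx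
  obtain ⟨hxe, hxY⟩ := Query.mem_evars_addHead.1 hxe
  obtain ⟨r, hr, s, hs, hrs⟩ := edge _ (Finset.filter_subset _ _) hxne (fun he => hxY (by
    rw [hY, Finset.mem_filter]
    exact ⟨hxe, Finset.filter_eq_self.1 he⟩))
  obtain ⟨z, hz, hzr, hzs⟩ := hrs.2.2
  have hadj' : (q.addHead Y).Adj s r := ⟨hrs.2.1, hrs.1, z, hz, hzs, hzr⟩
  have hr' := sg_nonempty r s z hrs hz hzr
  have hs' := sg_nonempty s r z hadj' hz hzs
  have hze := (Query.mem_evars_addHead.1 hz).1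
  rcases h.laminar x hxe z hze with h1 | h1 | h1
  · have hlt := Finset.card_lt_card ((Finset.ssubset_iff_of_subset h1).2 ⟨s, hs', hs⟩)
    have hle := hmax z (Finset.mem_filter.2 ⟨hz, r, hr'⟩)
    omega
  · exact Finset.disjoint_left.1 h1 hr hr'
  · exact hs (h1 hs')

/-- The labelling steers the recursion. For a connected query, a top set is chosen inside the
variables common to all labels, so projecting on it adds to each scope only what the label already
allows. For a disconnected one, the labelling restricts to the components. -/
theorem exists_mem_MP_scope_subset (hq : q.head ⊆ q.vars) (hne : q.rels.Nonempty) :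
    ∀ L, IsLabelling q L → ∃ P ∈ MP q, ∀ r ∈ q.rels, P.scope r ⊆ L r := by
  induction q, hq using MP_induction with
  | single q hq h =>
    intro L hL
    obtain ⟨r, hr⟩ := Finset.card_eq_one.1 h
    refine ⟨_, (mem_MP_of_card_eq_one h).2 ⟨r, hr, rfl⟩, fun s hs => ?_⟩
    rw [hr, Finset.mem_singleton] at hs
    subst hs
    split_ifs
    · exact Finset.empty_subset _
    · have hev : q.evars = q.varsOf s \ q.head := by simp [Query.evars, Query.vars, hr]
      have := hL.varsOf_subset s (by simp [hr])
      simpa [Plan.scope, Plan.rels, hev] using this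
  | connected q hq h hc ih =>
    intro L hL
    have hcard : 1 < q.rels.card := by
      have := Finset.card_pos.2 hne
      omega
    obtain ⟨y, hy, hyY⟩ := Query.exists_topSet_subset (Finset.filter_subset _ _)
      (hL.not_connected hcard)
    obtain ⟨P, hP, hPL⟩ := ih y hy (Query.head_addHead_subset hq hy) hne _ (hL.addHead y)
    refine ⟨_, (mem_MP_of_connected h hc).2 ⟨y, hy, P, hP, rfl⟩, fun r hr => ?_⟩
    simp only [Plan.scope]
    split_ifs
    · refine Finset.union_subset (fun x hx => ?_) ((hPL r hr).trans Finset.sdiff_subset)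
      exact (Finset.mem_filter.1 (hyY hx)).2 r hr
    · exact Finset.empty_subset _
  | disconnected q hq h hc ih =>
    intro L hL
    have hS : ∀ S : {S // S ∈ q.components}, ∃ P ∈ MP (q.restrict S.1),
        ∀ r ∈ S.1, P.scope r ⊆ L r ∩ (q.restrict S.1).evars := fun S =>
      ih S.1 S.2 (Query.head_restrict_subset S.1) (Query.nonempty_of_mem_components S.2) _
        (hL.restrict (Query.subset_of_mem_components S.2))
    choose f hf hfL using hS
    have hmem := (mem_MP_of_not_connected h hc).2 ⟨f, hf, rfl⟩
    refine ⟨_, hmem, fun r hr => ?_⟩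
    have hplan := isPlanFor_of_mem_MP hq _ hmem
    obtain ⟨S, hS⟩ := Plan.mem_rels_join.1 (hplan.2.1.symm ▸ hr)
    rw [hplan.1.scope_join hS]
    rw [hplan.1.2.1] at hS
    exact (hfL S r hS).trans Finset.inter_subset_left

theorem MP_nonempty (hq : q.head ⊆ q.vars) (hne : q.rels.Nonempty) : (MP q).Nonempty := by
  -- The coarsest labelling: with every existential variable on every atom, all sets of atoms
  -- coincide.
  have hL : IsLabelling q fun _ => q.evars :=
    ⟨fun r hr => Finset.sdiff_subset_sdiff (Finset.subset_biUnion_of_mem q.varsOf hr) subset_rfl,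
      fun _ _ => subset_rfl, fun x hx y hy => Or.inl (by simp [hx, hy])⟩
  obtain ⟨P, hP, -⟩ := exists_mem_MP_scope_subset hq hne _ hL
  exact ⟨P, hP⟩

/-! ### Minimal plans -/

theorem exists_mem_MP_dissociation_le (hq : q.head ⊆ q.vars) (hne : q.rels.Nonempty)
    {Δ : Rel → Finset V} (hΔ : q.IsSafeDissociation Δ) :
    ∃ P ∈ MP q, P.dissociation q ≤ Δ := by
  obtain ⟨P, hP, hPL⟩ := exists_mem_MP_scope_subset hq hne _ hΔ.isLabelling
  have hplan := isPlanFor_of_mem_MP hq P hP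
  refine ⟨P, hP, fun r => ?_⟩
  by_cases hr : r ∈ q.rels
  · rw [hplan.dissociation_eq]
    intro x hx
    obtain ⟨hx, hxr⟩ := Finset.mem_sdiff.1 hx
    have := hPL r hr hx
    simp only [Finset.mem_sdiff, Finset.mem_union] at this
    tauto
  · rw [hplan.isSafeDissociation.1.2 r hr]
    exact Finset.empty_subset _

theorem eq_of_mem_MP_of_dissociation_le (hq : q.head ⊆ q.vars) {P P' : Plan Rel V}
    (hP : P ∈ MP q) (hP' : P' ∈ MP q) (hle : P'.dissociation q ≤ P.dissociation q) : P' = P := by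
  refine eq_of_mem_MP_of_scope_subset hq P hP P' hP' fun r hr => ?_
  rw [(isPlanFor_of_mem_MP hq P hP).scope_eq hr, (isPlanFor_of_mem_MP hq P' hP').scope_eq hr]
  exact Finset.sdiff_subset_sdiff (Finset.union_subset_union_right (hle r)) subset_rfl

/-- A safe dissociation below that of a returned plan has another returned plan below it, and
incomparability closes the circle. Conversely, a minimal plan has the same dissociation as some
returned plan, hence equals it. -/
theorem mem_MP_iff_isMinimalFor (hq : q.head ⊆ q.vars) (hne : q.rels.Nonempty) (P : Plan Rel V) :
    P ∈ MP q ↔ P.IsMinimalFor q := by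
  constructor
  · intro hP
    have hplan := isPlanFor_of_mem_MP hq P hP
    refine ⟨hplan, hplan.isSafeDissociation, fun Δ hΔ hle => ?_⟩
    obtain ⟨P', hP', hle'⟩ := exists_mem_MP_dissociation_le hq hne hΔ
    rwa [← eq_of_mem_MP_of_dissociation_le hq hP hP' (hle'.trans hle)]
  · rintro ⟨hplan, hmin⟩
    obtain ⟨P', hP', hle⟩ := exists_mem_MP_dissociation_le hq hne hplan.isSafeDissociation
    have hplan' := isPlanFor_of_mem_MP hq P' hP'
    rw [hplan.eq_of_dissociation_eq hplan'
      ((hmin.le_of_le hplan'.isSafeDissociation hle).antisymm hle)]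
    exact hP'

theorem not_dominates_of_isMinimalFor {P P' : Plan Rel V} (hP : P.IsMinimalFor q)
    (hP' : P'.IsPlanFor q) : ¬ Plan.Dominates q P' P := by
  rintro ⟨hne, hle⟩
  exact hne (hP'.eq_of_dissociation_eq hP.1
    (hle.antisymm (hP.2.le_of_le hP'.isSafeDissociation hle)))

end

/-! ### Expectations over independent random subsets -/

section Expectation

variable {α : Type*} {f g : Finset α → ℝ}

/-- `f W` depends only on which elements of `S` belong to `W`. -/
def DependsOnlyOn (f : Finset α → ℝ) (S : Set α) : Prop :=
  ∀ W W' : Finset α, (∀ t ∈ S, t ∈ W ↔ t ∈ W') → f W = f W'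

theorem DependsOnlyOn.mono {S S' : Set α} (h : DependsOnlyOn f S) (hS : S ⊆ S') :
    DependsOnlyOn f S' := fun W W' hW => h W W' fun t ht => hW t (hS ht)

theorem DependsOnlyOn.prod {ι : Type*} {I : Finset ι} {f : ι → Finset α → ℝ} {S : Set α}
    (h : ∀ i ∈ I, DependsOnlyOn (f i) S) : DependsOnlyOn (fun W => ∏ i ∈ I, f i W) S :=
  fun W W' hW => Finset.prod_congr rfl fun i hi => h i hi W W' hW

theorem DependsOnlyOn.one_sub {S : Set α} (h : DependsOnlyOn f S) :
    DependsOnlyOn (fun W => 1 - f W) S :=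
  fun W W' hW => congrArg (1 - ·) (h W W' hW)

variable {T : Finset α} {p : α → ℝ}

/-- The expectation of `f W` for the random subset `W` of `T` that contains each `t ∈ T`
independently with probability `p t`. -/
def expect (T : Finset α) (p : α → ℝ) (f : Finset α → ℝ) : ℝ :=
  ∑ W ∈ T.powerset, (∏ t ∈ W, p t) * (∏ t ∈ T \ W, (1 - p t)) * f W

theorem expect_empty : expect ∅ p f = f ∅ := by simp [expect]

theorem expect_insert {t : α} (ht : t ∉ T) :
    expect (insert t T) p f = p t * expect T p (fun W => f (insert t W)) +
      (1 - p t) * expect T p f := by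
  rw [expect, Finset.sum_powerset_insert ht, add_comm, expect, expect, Finset.mul_sum,
    Finset.mul_sum]
  congr 1 <;> refine Finset.sum_congr rfl fun W hW => ?_
  · have htW : t ∉ W := fun h => ht (Finset.mem_powerset.1 hW h)
    rw [Finset.prod_insert htW, Finset.insert_sdiff_insert, Finset.sdiff_insert_of_notMem ht]
    ring
  · have htW : t ∉ W := fun h => ht (Finset.mem_powerset.1 hW h)
    rw [Finset.insert_sdiff_of_notMem _ htW,
      Finset.prod_insert fun h => ht (Finset.mem_sdiff.1 h).1]
    ring

theorem expect_congr (h : ∀ W ⊆ T, f W = g W) : expect T p f = expect T p g :=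
  Finset.sum_congr rfl fun W hW => by rw [h W (Finset.mem_powerset.1 hW)]

theorem expect_mono (hp : ∀ t ∈ T, p t ∈ Set.Icc (0 : ℝ) 1) (h : ∀ W ⊆ T, f W ≤ g W) :
    expect T p f ≤ expect T p g := by
  refine Finset.sum_le_sum fun W hW => ?_
  have hW' := Finset.mem_powerset.1 hW
  refine mul_le_mul_of_nonneg_left (h W hW') (mul_nonneg ?_ ?_)
  · exact Finset.prod_nonneg fun t ht => (hp t (hW' ht)).1
  · exact Finset.prod_nonneg fun t ht => sub_nonneg.2 (hp t (Finset.mem_sdiff.1 ht).1).2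

theorem expect_nonneg (hp : ∀ t ∈ T, p t ∈ Set.Icc (0 : ℝ) 1) (h : ∀ W ⊆ T, 0 ≤ f W) :
    0 ≤ expect T p f := by
  refine Finset.sum_nonneg fun W hW => ?_
  have hW' := Finset.mem_powerset.1 hW
  refine mul_nonneg (mul_nonneg ?_ ?_) (h W hW')
  · exact Finset.prod_nonneg fun t ht => (hp t (hW' ht)).1
  · exact Finset.prod_nonneg fun t ht => sub_nonneg.2 (hp t (Finset.mem_sdiff.1 ht).1).2

theorem expect_const (c : ℝ) : expect T p (fun _ => c) = c := by
  induction T using Finset.induction_on with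
  | empty => exact expect_empty
  | insert t T ht ih => rw [expect_insert ht, ih]; ring

theorem expect_add : expect T p (fun W => f W + g W) = expect T p f + expect T p g := by
  simp only [expect, mul_add, Finset.sum_add_distrib]

theorem expect_const_mul (c : ℝ) : expect T p (fun W => c * f W) = c * expect T p f := by
  rw [expect, expect, Finset.mul_sum]
  exact Finset.sum_congr rfl fun W _ => by ring

theorem expect_one_sub : expect T p (fun W => 1 - f W) = 1 - expect T p f := by
  have h : expect T p (fun W => 1 + -1 * f W) = 1 + -1 * expect T p f := by
    rw [expect_add (f := fun _ => 1), expect_const, expect_const_mul]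
  simpa [sub_eq_add_neg] using h

theorem expect_union {T' : Finset α} (hd : Disjoint T T') :
    expect (T ∪ T') p f = expect T p fun W => expect T' p fun W' => f (W ∪ W') := by
  induction T using Finset.induction_on generalizing f with
  | empty => simp [expect_empty]
  | insert t T ht ih =>
    rw [Finset.disjoint_insert_left] at hd
    rw [Finset.insert_union, expect_insert (by simp [ht, hd.1]), expect_insert ht, ih hd.2,
      ih hd.2]
    simp only [Finset.insert_union]

theorem expect_mem (t : α) :
    expect T p (fun W => if t ∈ W then 1 else 0) = if t ∈ T then p t else 0 := by
  have hout : ∀ T : Finset α, t ∉ T → expect T p (fun W => if t ∈ W then 1 else 0) = 0 := by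
    intro T ht
    rw [expect_congr (g := fun _ => 0) fun W hW => if_neg fun h => ht (hW h), expect_const]
  split_ifs with ht
  · rw [← Finset.insert_erase ht, expect_insert (Finset.notMem_erase t T),
      hout _ (Finset.notMem_erase t T)]
    simp [expect_const]
  · exact hout T ht

theorem DependsOnlyOn.comp_insert {S : Set α} (h : DependsOnlyOn f S) (t : α) :
    DependsOnlyOn (fun W => f (insert t W)) S := by
  refine fun W W' hW => h _ _ fun s hs => ?_
  rw [Finset.mem_insert, Finset.mem_insert, hW s hs]

theorem DependsOnlyOn.insert_eq {S : Set α} (h : DependsOnlyOn f S) {t : α} (ht : t ∉ S)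
    (W : Finset α) : f (insert t W) = f W := by
  refine h _ _ fun s hs => ?_
  rw [Finset.mem_insert, or_iff_right]
  rintro rfl
  exact ht hs

/-- Conditioning on one element at a time: each element affects at most one of the factors, so the
other can be pulled out. -/
theorem expect_mul {S S' : Set α} (hS : Disjoint S S') (hf : DependsOnlyOn f S)
    (hg : DependsOnlyOn g S') :
    expect T p (fun W => f W * g W) = expect T p f * expect T p g := by
  induction T using Finset.induction_on generalizing f g with
  | empty => simp [expect_empty]
  | insert t T ht ih =>
    rw [expect_insert ht, expect_insert ht, expect_insert ht, ih hf hg,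
      ih (hf.comp_insert t) (hg.comp_insert t)]
    by_cases htS : t ∈ S
    · simp only [hg.insert_eq (Set.disjoint_left.1 hS htS)]
      ring
    · simp only [hf.insert_eq htS]
      ring

theorem expect_prod {ι : Type*} {I : Finset ι} {f : ι → Finset α → ℝ} {S : ι → Set α}
    (hS : ∀ i ∈ I, ∀ j ∈ I, i ≠ j → Disjoint (S i) (S j))
    (hf : ∀ i ∈ I, DependsOnlyOn (f i) (S i)) :
    expect T p (fun W => ∏ i ∈ I, f i W) = ∏ i ∈ I, expect T p (f i) := by
  induction I using Finset.induction_on with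
  | empty => simp [expect_const]
  | insert a I ha ih =>
    have hI : DependsOnlyOn (fun W => ∏ i ∈ I, f i W) (⋃ i ∈ I, S i) :=
      DependsOnlyOn.prod fun i hi =>
        (hf i (Finset.mem_insert_of_mem hi)).mono (Set.subset_biUnion_of_mem (u := S) hi)
    simp only [Finset.prod_insert ha]
    rw [expect_mul ?_ (hf a (Finset.mem_insert_self a I)) hI, ih]
    · exact fun i hi j hj => hS i (Finset.mem_insert_of_mem hi) j (Finset.mem_insert_of_mem hj)
    · exact fun i hi => hf i (Finset.mem_insert_of_mem hi)
    · refine Set.disjoint_iUnion₂_right.2 fun i hi => ?_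
      refine hS a (Finset.mem_insert_self a I) i (Finset.mem_insert_of_mem hi) ?_
      rintro rfl
      exact ha hi

/-- Replacing the variables of a monotone DNF by independent copies with the same probabilities, in
such a way that no conjunct contains two copies of the same variable, does not decrease the
probability that the formula is true. -/
theorem expect_le_expect_of_copies {β : Type*} {T' : Finset β} {p' : β → ℝ}
    (π : β → α) (hp : ∀ t ∈ T, p t ∈ Set.Icc (0 : ℝ) 1)
    (hp' : ∀ b ∈ T', p' b ∈ Set.Icc (0 : ℝ) 1) (hpp' : ∀ b ∈ T', p' b = p (π b))
    (𝓜 : Set (Finset β)) (hinj : ∀ M ∈ 𝓜, Set.InjOn π M)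
    (hmem : ∀ M ∈ 𝓜, ∀ b ∈ M, π b ∈ T → b ∈ T') :
    expect T p (fun W => if ∃ M ∈ 𝓜, ∀ b ∈ M, π b ∈ W then 1 else 0) ≤
      expect T' p' (fun W => if ∃ M ∈ 𝓜, M ⊆ W then 1 else 0) := by
  induction T using Finset.induction_on generalizing T' 𝓜 with
  | empty =>
    rw [expect_empty]
    split_ifs with h
    · obtain ⟨M, hM, h⟩ := h
      rw [expect_congr (g := fun _ => 1) fun W _ =>
        if_pos ⟨M, hM, fun b hb => absurd (h b hb) (Finset.notMem_empty _)⟩, expect_const]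
    · refine expect_nonneg hp' fun W _ => ?_
      split_ifs <;> norm_num
  | insert t T ht ih =>
    set T₁ := T'.filter fun b => π b ≠ t with hT₁
    set T₂ := T'.filter fun b => π b = t with hT₂
    have hT' : T' = T₁ ∪ T₂ := by
      rw [hT₁, hT₂, Finset.union_comm, Finset.filter_union_filter_not_eq]
    have hd : Disjoint T₁ T₂ := (Finset.disjoint_filter_filter_not T' T' _).symm
    have hsub₁ : T₁ ⊆ T' := Finset.filter_subset _ _
    have hsub₂ : T₂ ⊆ T' := Finset.filter_subset _ _
    have hpT : ∀ s ∈ T, p s ∈ Set.Icc (0 : ℝ) 1 := fun s hs => hp s (Finset.mem_insert_of_mem hs)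
    have hpt := hp t (Finset.mem_insert_self t T)
    -- Condition on `t`. If `t` is present, its copies can be deleted from the conjuncts (`ih₁`); if
    -- absent, the conjuncts using a copy of `t` are dropped (`ih₀`).
    have ih₁ := ih hpT (fun b hb => hp' b (hsub₁ hb)) (fun b hb => hpp' b (hsub₁ hb))
      ((fun M : Finset β => M.filter fun b => π b ≠ t) '' 𝓜)
      (by
        rintro _ ⟨M, hM, rfl⟩
        exact (hinj M hM).mono (Finset.coe_subset.2 (Finset.filter_subset _ _)))
      (by
        rintro _ ⟨M, hM, rfl⟩ b hb hbT
        obtain ⟨hb, hbt⟩ := Finset.mem_filter.1 hb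
        exact Finset.mem_filter.2 ⟨hmem M hM b hb (Finset.mem_insert_of_mem hbT), hbt⟩)
    have ih₀ := ih hpT (fun b hb => hp' b (hsub₁ hb)) (fun b hb => hpp' b (hsub₁ hb))
      {M ∈ 𝓜 | ∀ b ∈ M, π b ≠ t} (fun M hM => hinj M hM.1)
      (fun M hM b hb hbT => Finset.mem_filter.2
        ⟨hmem M hM.1 b hb (Finset.mem_insert_of_mem hbT), hM.2 b hb⟩)
    simp only [Set.exists_mem_image] at ih₁
    rw [expect_insert ht, hT', expect_union hd]
    refine le_trans (add_le_add (mul_le_mul_of_nonneg_left (le_trans (le_of_eq ?_) ih₁) hpt.1)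
      (mul_le_mul_of_nonneg_left (le_trans (le_of_eq ?_) ih₀) (sub_nonneg.2 hpt.2))) ?_
    · refine expect_congr fun W hW => if_congr (exists_congr fun M => and_congr_right fun hM => ?_)
        rfl rfl
      refine forall_congr' fun b => ?_
      simp only [Finset.mem_insert, Finset.mem_filter]
      tauto
    · refine expect_congr fun W hW => if_congr (exists_congr fun M => ?_) rfl rfl
      constructor
      · rintro ⟨hM, h⟩
        refine ⟨⟨hM, fun b hb hbt => ht (hW ?_)⟩, h⟩
        rw [← hbt]
        exact h b hb
      · rintro ⟨⟨hM, -⟩, h⟩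
        exact ⟨hM, h⟩
    -- With the outcome `W` of the copies of other variables fixed, only the copies of `t` remain
    -- random, and the inequality is checked pointwise in `W`.
    · rw [← expect_const_mul, ← expect_const_mul, ← expect_add]
      refine expect_mono (fun b hb => hp' b (hsub₁ hb)) fun W hW => ?_
      have hp₂ : ∀ b ∈ T₂, p' b ∈ Set.Icc (0 : ℝ) 1 := fun b hb => hp' b (hsub₂ hb)
      by_cases h₀ : ∃ M ∈ {M ∈ 𝓜 | ∀ b ∈ M, π b ≠ t}, M ⊆ W
      · rw [if_pos h₀]
        obtain ⟨M, hM, hMW⟩ := h₀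
        rw [expect_congr (T := T₂) (g := fun _ => 1) fun W' _ =>
          if_pos ⟨M, hM.1, hMW.trans Finset.subset_union_left⟩, expect_const]
        have h1 := hpt.1
        split_ifs <;> linarith
      rw [if_neg h₀]
      split_ifs with h₁
      -- The critical case: the formula holds only thanks to `t`. By injectivity `M` contains
      -- exactly one copy `b` of `t`, and its presence, of probability `p t`, already satisfies `M`.
      · obtain ⟨M, hM, hMW⟩ := h₁
        have hb : ∃ b ∈ M, π b = t := by
          by_contra! hno
          refine h₀ ⟨M, ⟨hM, hno⟩, ?_⟩
          rwa [Finset.filter_true_of_mem hno] at hMW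
        obtain ⟨b, hbM, hbt⟩ := hb
        have hbT₂ : b ∈ T₂ := Finset.mem_filter.2
          ⟨hmem M hM b hbM (by rw [hbt]; exact Finset.mem_insert_self t T), hbt⟩
        have hpb : p t = expect T₂ p' fun W => if b ∈ W then 1 else 0 := by
          rw [expect_mem, if_pos hbT₂, hpp' b (hsub₂ hbT₂), hbt]
        rw [mul_one, mul_zero, add_zero, hpb]
        refine expect_mono hp₂ fun W' _ => ?_
        split_ifs with h1 h2 h2
        · exact le_rfl
        · refine absurd ⟨M, hM, fun c hc => ?_⟩ h2
          by_cases hct : π c = t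
          · rw [hinj M hM hc hbM (hct.trans hbt.symm)]
            exact Finset.mem_union_right _ h1
          · exact Finset.mem_union_left _ (hMW (Finset.mem_filter.2 ⟨hc, hct⟩))
        · exact zero_le_one
        · exact le_rfl
      · rw [mul_zero, mul_zero, add_zero]
        refine expect_nonneg hp₂ fun W' _ => ?_
        split_ifs <;> norm_num

end Expectation

theorem reliability_eq_expect (D : Database attr C) (q : Query attr V C) (ν : V → C) :
    reliability D q ν =
      expect D.tuples D.prob fun W => if q.HoldsIn W ν then 1 else 0 := by
  rw [reliability, expect, Finset.sum_filter]
  refine Finset.sum_congr rfl fun W _ => ?_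
  rw [mul_ite, mul_one, mul_zero, Database.worldProb]
  congr!

/-! ### Dissociations increase the reliability -/

section

variable [∀ r, Fintype (attr r)] {q : Query attr V C} {D : Database attr C}

theorem Database.mem_tuples_dissociate {Δ : Rel → Finset V} {t : Σ r, DissAttr attr Δ r → C} :
    t ∈ (D.dissociate Δ).tuples ↔ (⟨t.1, fun i => t.2 (Sum.inl i)⟩ : Σ r, attr r → C) ∈ D.tuples ∧
      ∀ y, t.2 (Sum.inr y) ∈ D.activeDomain := by
  obtain ⟨r, a⟩ := t
  simp only [dissociate, Finset.mem_biUnion, Finset.mem_image, Fintype.mem_piFinset]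
  constructor
  · rintro ⟨s, hs, τ, hτ, h⟩
    obtain ⟨rfl, h⟩ := Sigma.mk.inj_iff.1 h
    obtain rfl := eq_of_heq h
    exact ⟨hs, hτ⟩
  · rintro ⟨h, hA⟩
    refine ⟨_, h, fun y => a (Sum.inr y), hA, ?_⟩
    congr 1
    funext i
    cases i <;> rfl

theorem Database.mem_activeDomain {t : Σ r, attr r → C} (ht : t ∈ D.tuples) (i : attr t.1) :
    t.2 i ∈ D.activeDomain :=
  Finset.mem_biUnion.2 ⟨t, ht, Finset.mem_image_of_mem _ (Finset.mem_univ i)⟩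

theorem Database.mem_activeDomain_of_dissociate {Δ : Rel → Finset V}
    {t : Σ r, DissAttr attr Δ r → C} (ht : t ∈ (D.dissociate Δ).tuples) (i : DissAttr attr Δ t.1) :
    t.2 i ∈ D.activeDomain := by
  obtain ⟨h, hA⟩ := mem_tuples_dissociate.1 ht
  cases i with
  | inl i => exact mem_activeDomain h i
  | inr y => exact hA y

/-- Tuples of the larger dissociation are copies of those of the smaller one, with `π` forgetting
the extra attributes. A grounding uses one tuple per relation symbol, so no conjunct contains two
copies of the same tuple. -/
theorem reliability_dissociate_mono {Δ Δ' : Rel → Finset V} (hΔ' : q.IsDissociation Δ')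
    (hle : Δ ≤ Δ') (ν : V → C) :
    reliability (D.dissociate Δ) (q.dissociate Δ) ν ≤
      reliability (D.dissociate Δ') (q.dissociate Δ') ν := by
  set π : (Σ r, DissAttr attr Δ' r → C) → Σ r, DissAttr attr Δ r → C := fun t =>
    ⟨t.1, fun i => t.2 (Sum.map id (fun y => ⟨y.1, hle t.1 y.2⟩) i)⟩ with hπ
  have hground : ∀ μ r, π ((q.dissociate Δ').ground μ r) = (q.dissociate Δ).ground μ r := by
    intro μ r
    simp only [hπ, Query.ground]
    congr 1
    funext i
    cases i <;> rfl
  -- Values are restricted to the active domain so that the required copies exist in the larger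
  -- database. Nothing is lost, since an assignment satisfying the query in a possible world takes
  -- only such values on its variables.
  set 𝓜 : Set (Finset (Σ r, DissAttr attr Δ' r → C)) := {M | ∃ μ : V → C,
    (∀ x ∈ q.head, μ x = ν x) ∧ (∀ x ∈ q.vars, μ x ∈ D.activeDomain) ∧
      M = q.rels.image ((q.dissociate Δ').ground μ)} with h𝓜
  rw [reliability_eq_expect, reliability_eq_expect]
  refine le_trans ?_ (le_trans (expect_le_expect_of_copies (T := (D.dissociate Δ).tuples)
    (p := (D.dissociate Δ).prob) (T' := (D.dissociate Δ').tuples) (p' := (D.dissociate Δ').prob)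
    π (D.dissociate Δ).prob_mem (D.dissociate Δ').prob_mem (fun _ _ => rfl) 𝓜 ?_ ?_) ?_)
  · refine expect_mono (D.dissociate Δ).prob_mem fun W hW => ?_
    split_ifs with h1 h2 h2
    · exact le_rfl
    · obtain ⟨μ, hμ, hμW⟩ := h1
      refine absurd ⟨_, ⟨μ, hμ, fun x hx => ?_, rfl⟩, fun b hb => ?_⟩ h2
      · obtain ⟨r, hr, hxr⟩ := Query.mem_vars.1 hx
        obtain ⟨i, hi⟩ := Query.mem_varsOf.1 hxr
        have := Database.mem_activeDomain_of_dissociate (hW (hμW r hr)) (Sum.inl i)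
        simpa [Query.ground, Query.dissociate, hi] using this
      · obtain ⟨r, hr, rfl⟩ := Finset.mem_image.1 hb
        rw [hground]
        exact hμW r hr
    · exact zero_le_one
    · exact le_rfl
  · rintro _ ⟨μ, -, -, rfl⟩ a ha b hb hab
    obtain ⟨r, -, rfl⟩ := Finset.mem_image.1 (Finset.mem_coe.1 ha)
    obtain ⟨s, -, rfl⟩ := Finset.mem_image.1 (Finset.mem_coe.1 hb)
    have hrs : r = s := congrArg Sigma.fst hab
    rw [hrs]
  · rintro _ ⟨μ, -, hμ, rfl⟩ b hb hbT
    obtain ⟨r, hr, rfl⟩ := Finset.mem_image.1 hb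
    refine Database.mem_tuples_dissociate.2 ⟨(Database.mem_tuples_dissociate.1 hbT).1, fun y => ?_⟩
    exact hμ y.1 (Finset.mem_sdiff.1 (hΔ'.1 r hr y.2)).1
  · refine expect_mono (D.dissociate Δ').prob_mem fun W hW => ?_
    split_ifs with h1 h2 h2
    · exact le_rfl
    · obtain ⟨_, ⟨μ, hμ, -, rfl⟩, hμW⟩ := h1
      exact absurd ⟨μ, hμ, fun r hr => hμW (Finset.mem_image_of_mem _ hr)⟩ h2
    · exact zero_le_one
    · exact le_rfl

end

/-! ### Extensional evaluation of a plan over arbitrary tuple weights -/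

namespace Plan

/-- The valuation that agrees with `τ` on `y` and with `ν` elsewhere. -/
def extend (y : Finset V) (ν : V → C) (τ : {x : V // x ∈ y} → C) (x : V) : C :=
  if h : x ∈ y then τ ⟨x, h⟩ else ν x

theorem extend_of_mem {y : Finset V} {ν : V → C} {τ : {x : V // x ∈ y} → C} {x : V} (h : x ∈ y) :
    extend y ν τ x = τ ⟨x, h⟩ := dif_pos h

theorem extend_of_notMem {y : Finset V} {ν : V → C} {τ : {x : V // x ∈ y} → C} {x : V}
    (h : x ∉ y) : extend y ν τ x = ν x := dif_neg h

/-- The extensional score of a plan over the atoms of `q` for the tuple weights `wt`, with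
projections ranging over values in `A`. -/
def value (q : Query attr V C) (A : Finset C) (wt : (Σ r, attr r → C) → ℝ) :
    Plan Rel V → (V → C) → ℝ
  | atom r => fun ν => wt (q.ground ν r)
  | proj y P => fun ν => 1 - ∏ τ ∈ Fintype.piFinset (fun _ : {x : V // x ∈ y} => A),
      (1 - P.value q A wt (extend y ν τ))
  | join _ P => fun ν => ∏ S, (P S).value q A wt ν

/-- The weight `p t` for the tuples `t` of `T`, and `0` for all others. -/
def weight (T : Finset (Σ r, attr r → C)) (p : (Σ r, attr r → C) → ℝ) (t : Σ r, attr r → C) : ℝ :=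
  if t ∈ T then p t else 0

theorem weight_congr {T : Finset (Σ r, attr r → C)} {p : (Σ r, attr r → C) → ℝ}
    {T' : Finset (Σ r, attr' r → C)} {p' : (Σ r, attr' r → C) → ℝ} {t : Σ r, attr r → C}
    {t' : Σ r, attr' r → C} (h : t ∈ T ↔ t' ∈ T') (hp : p t = p' t') :
    weight T p t = weight T' p' t' := by
  simp only [weight, h, hp]

/-- The indicator function of a possible world. -/
def indicator (W : Finset (Σ r, attr r → C)) (t : Σ r, attr r → C) : ℝ := if t ∈ W then 1 else 0

/-- The tuples that the value of the plan at `ν` depends on. -/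
def support (q : Query attr V C) (P : Plan Rel V) (ν : V → C) : Set (Σ r, attr r → C) :=
  {t | t.1 ∈ P.rels ∧ ∀ x, P.projCount x = 0 → ∀ i, q.args t.1 i = Sum.inl x → t.2 i = ν x}

theorem support_proj_subset (q : Query attr V C) (y : Finset V) (P : Plan Rel V) (ν : V → C)
    (τ : {x : V // x ∈ y} → C) : P.support q (extend y ν τ) ⊆ (proj y P).support q ν := by
  rintro t ⟨ht, h⟩
  refine ⟨ht, fun x hx i hi => ?_⟩
  by_cases hxy : x ∈ y
  · simp [projCount, hxy] at hx
  · rw [h x (Nat.eq_zero_of_le_zero ((projCount_le_proj y P x).trans hx.le)) i hi,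
      extend_of_notMem hxy]

theorem support_join_subset (q : Query attr V C) {parts : Finset (Finset Rel)}
    (P : {S // S ∈ parts} → Plan Rel V) (ν : V → C) (S : {S // S ∈ parts}) :
    (P S).support q ν ⊆ (join parts P).support q ν := by
  rintro t ⟨ht, h⟩
  exact ⟨mem_rels_join.2 ⟨S, ht⟩, fun x hx =>
    h x (Nat.eq_zero_of_le_zero ((projCount_le_join S x).trans hx.le))⟩

theorem dependsOnlyOn_value (q : Query attr V C) (A : Finset C) (P : Plan Rel V) (ν : V → C) :
    DependsOnlyOn (fun W => P.value q A (indicator W) ν) (P.support q ν) := by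
  induction P generalizing ν with
  | atom r =>
    intro W W' h
    have : q.ground ν r ∈ support q (atom r) ν :=
      ⟨Finset.mem_singleton_self r, fun x _ i hi => by
        change Sum.elim ν id (q.args r i) = ν x
        have hi' : q.args r i = Sum.inl x := hi
        rw [hi', Sum.elim_inl]⟩
    simp only [value, indicator, h _ this]
  | proj y P ih =>
    exact (DependsOnlyOn.prod fun τ _ =>
      ((ih (extend y ν τ)).mono (support_proj_subset q y P ν τ)).one_sub).one_sub
  | join parts P ih =>
    exact DependsOnlyOn.prod fun S _ => (ih S ν).mono (support_join_subset q P ν S)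

theorem score_eq_value [∀ r, Fintype (attr r)] (D : Database attr C) (q : Query attr V C)
    (P : Plan Rel V) (ν : V → C) :
    P.score D q ν =
      P.value q D.activeDomain (weight D.tuples D.prob) ν := by
  induction P generalizing ν with
  | atom r =>
    simp only [score, value, weight]
    congr!
  | proj y P ih =>
    simp only [score, value]
    refine congrArg (1 - ·) (Finset.prod_congr rfl fun τ _ => ?_)
    rw [ih]
    rfl
  | join parts P ih =>
    simp only [score, value]
    exact Finset.prod_congr rfl fun S _ => ih S ν

theorem ground_congr [∀ r, Fintype (attr r)] {q : Query attr V C} {μ μ' : V → C} {r : Rel}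
    (h : ∀ x ∈ q.varsOf r, μ x = μ' x) :
    q.ground μ r = q.ground μ' r := by
  unfold Query.ground
  congr 1
  funext i
  cases hi : q.args r i with
  | inl x => exact h x (Query.mem_varsOf.2 ⟨i, hi⟩)
  | inr c => rfl

/-- Every projection of the plan on `x` is above precisely the atoms of the plan that contain `x`
in `q`. -/
def Adapted [∀ r, Fintype (attr r)] (q : Query attr V C) (P : Plan Rel V) : Prop :=
  ∀ r ∈ P.rels, ∀ x, x ∈ P.scope r ↔ x ∈ q.varsOf r ∧ 0 < P.projCount x

-- Two queries over different schemas are in play: well-formedness refers to the original `q₀`,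
-- while values and `Adapted` refer to `q`, later its dissociation.
variable [∀ r, Fintype (attr r)] [∀ r, Fintype (attr' r)] {q₀ : Query attr' V C}
  {q : Query attr V C} {A : Finset C}

theorem Adapted.of_proj {y : Finset V} {P : Plan Rel V} (ha : (proj y P).Adapted q)
    (h : (proj y P).Proper q₀) : P.Adapted q := by
  intro r hr x
  rw [h.scope_of_proj hr, Finset.mem_sdiff, ha r hr x]
  by_cases hxy : x ∈ y
  · simp [hxy, projCount_proj_of_mem (h.projCount_le x) hxy]
  · simp [projCount, hxy]

/-- If a sibling operand projected `x` away, adaptedness would put `x` in the scope of `r`, which is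
determined inside the operand containing `r`. -/
theorem Adapted.projCount_eq_zero {parts : Finset (Finset Rel)}
    {P : {S // S ∈ parts} → Plan Rel V} (ha : (join parts P).Adapted q)
    (h : (join parts P).Proper q₀) {S : {S // S ∈ parts}} {r : Rel} (hr : r ∈ (P S).rels) {x : V}
    (hx : x ∈ q.varsOf r) (hS : (P S).projCount x = 0) : (join parts P).projCount x = 0 := by
  by_contra hne
  have := (ha r (mem_rels_join.2 ⟨S, hr⟩) x).2 ⟨hx, Nat.pos_of_ne_zero hne⟩
  rw [h.wellFormed.scope_join hr] at this
  have := projCount_pos_of_mem_scope this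
  omega

theorem Adapted.of_join {parts : Finset (Finset Rel)} {P : {S // S ∈ parts} → Plan Rel V}
    (ha : (join parts P).Adapted q) (h : (join parts P).Proper q₀) (S : {S // S ∈ parts}) :
    (P S).Adapted q := by
  intro r hr x
  have hr' := mem_rels_join.2 ⟨S, hr⟩
  rw [← h.wellFormed.scope_join hr, ha r hr' x]
  refine and_congr_right fun hx => ⟨fun hpos => ?_, fun hpos => hpos.trans_le (projCount_le_join S x)⟩
  by_contra hS
  have := ha.projCount_eq_zero h hr hx (by omega)
  omega

theorem Adapted.mem_varsOf {y : Finset V} {P : Plan Rel V} (ha : (proj y P).Adapted q)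
    (h : (proj y P).Proper q₀) {r : Rel} (hr : r ∈ P.rels) {x : V} (hx : x ∈ y) :
    x ∈ q.varsOf r :=
  ((ha r hr x).1 (h.mem_iff_of_proj.1 hx r hr)).1

/-- The value of an adapted plan commutes with expectations, as the operands of its operators are
independent. -/
theorem expect_value (T : Finset (Σ r, attr r → C)) (p : (Σ r, attr r → C) → ℝ) {P : Plan Rel V}
    (h : P.Proper q₀) (ha : P.Adapted q) (ν : V → C) :
    expect T p (fun W => P.value q A (indicator W) ν) =
      P.value q A (weight T p) ν := by
  induction P generalizing ν with
  | atom r =>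
    simp only [value, indicator, weight]
    convert expect_mem (T := T) (p := p) (q.ground ν r)
  | proj y P ih =>
    -- A projected variable occurs in every atom below, so each tuple in a support displays its
    -- value. Different values thus involve different tuples.
    have hpd : ∀ τ ∈ Fintype.piFinset (fun _ : {x : V // x ∈ y} => A),
        ∀ τ' ∈ Fintype.piFinset (fun _ : {x : V // x ∈ y} => A), τ ≠ τ' →
        Disjoint (P.support q (extend y ν τ)) (P.support q (extend y ν τ')) := by
      intro τ _ τ' _ hne
      refine Set.disjoint_left.2 ?_
      rintro t ⟨ht, h1⟩ ⟨-, h2⟩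
      refine hne (funext fun ⟨x, hx⟩ => ?_)
      have h0 := projCount_proj_of_mem (h.projCount_le x) hx
      obtain ⟨i, hi⟩ := Query.mem_varsOf.1 (ha.mem_varsOf h ht hx)
      rw [← extend_of_mem (ν := ν) (τ := τ) hx, ← extend_of_mem (ν := ν) (τ := τ') hx,
        ← h1 x h0 i hi, h2 x h0 i hi]
    simp only [value]
    rw [expect_one_sub, expect_prod hpd fun τ _ => (dependsOnlyOn_value q A P _).one_sub]
    refine congrArg (1 - ·) (Finset.prod_congr rfl fun τ _ => ?_)
    rw [expect_one_sub, ih h.of_proj (ha.of_proj h)]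
  | join parts P ih =>
    simp only [value]
    rw [expect_prod (S := fun S => (P S).support q ν) ?_ fun S _ => dependsOnlyOn_value q A (P S) ν]
    · exact Finset.prod_congr rfl fun S _ => ih S (h.of_join S) (ha.of_join h S) ν
    · intro S _ T _ hST
      refine Set.disjoint_left.2 fun t ht ht' => hST ?_
      exact h.wellFormed.eq_of_mem_rels ht.1 ht'.1

/-- The body of the plan is satisfied in `W` by an assignment that agrees with `ν` on the variables
that are not projected away. -/
def HoldsIn (q : Query attr V C) (P : Plan Rel V) (W : Finset (Σ r, attr r → C)) (ν : V → C) :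
    Prop :=
  ∃ μ : V → C, (∀ x, P.projCount x = 0 → μ x = ν x) ∧ ∀ r ∈ P.rels, q.ground μ r ∈ W

theorem holdsIn_proj_iff {y : Finset V} {P : Plan Rel V} (h : (proj y P).Proper q₀)
    (ha : (proj y P).Adapted q) {W : Finset (Σ r, attr r → C)} (hA : ∀ t ∈ W, ∀ i, t.2 i ∈ A)
    {ν : V → C} :
    (proj y P).HoldsIn q W ν ↔
      ∃ τ ∈ Fintype.piFinset (fun _ : {x : V // x ∈ y} => A), P.HoldsIn q W (extend y ν τ) := by
  constructor
  · rintro ⟨μ, hμ, hW⟩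
    refine ⟨fun x => μ x.1, Fintype.mem_piFinset.2 fun x => ?_, μ, fun x hx => ?_, hW⟩
    · obtain ⟨r, hr⟩ := h.of_proj.wellFormed.rels_nonempty
      obtain ⟨i, hi⟩ := Query.mem_varsOf.1 (ha.mem_varsOf h hr x.2)
      have := hA _ (hW r hr) i
      simpa [Query.ground, hi] using this
    · by_cases hxy : x ∈ y
      · rw [extend_of_mem hxy]
      · rw [extend_of_notMem hxy, hμ x (by simp [projCount, hxy, hx])]
  · rintro ⟨τ, -, μ, hμ, hW⟩
    refine ⟨μ, fun x hx => ?_, hW⟩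
    by_cases hxy : x ∈ y
    · simp [projCount, hxy] at hx
    · rw [hμ x (Nat.eq_zero_of_le_zero ((projCount_le_proj y P x).trans hx.le)),
        extend_of_notMem hxy]

/-- Witnesses of the operands glue: each projected variable belongs to one operand, and the other
variables follow `ν` everywhere. -/
theorem holdsIn_join_iff {parts : Finset (Finset Rel)} {P : {S // S ∈ parts} → Plan Rel V}
    (h : (join parts P).Proper q₀) (ha : (join parts P).Adapted q)
    {W : Finset (Σ r, attr r → C)} {ν : V → C} :
    (join parts P).HoldsIn q W ν ↔ ∀ S, (P S).HoldsIn q W ν := by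
  constructor
  · rintro ⟨μ, hμ, hW⟩ S
    refine ⟨fun x => if (P S).projCount x = 0 then ν x else μ x, fun x hx => if_pos hx,
      fun r hr => ?_⟩
    rw [ground_congr (μ' := μ) fun x hx => ?_]
    · exact hW r (mem_rels_join.2 ⟨S, hr⟩)
    · split_ifs with hS
      · exact (hμ x (ha.projCount_eq_zero h hr hx hS)).symm
      · rfl
  · intro hS
    choose μ hμ hW using hS
    refine ⟨fun x => if hx : ∃ S, 0 < (P S).projCount x then μ hx.choose x else ν x,
      fun x hx => dif_neg ?_, fun r hr => ?_⟩
    · rintro ⟨S, hS⟩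
      have := projCount_le_join (P := P) S x
      omega
    · obtain ⟨S, hr⟩ := mem_rels_join.1 hr
      rw [ground_congr (μ' := μ S) fun x hx => ?_]
      · exact hW S r hr
      · split_ifs with hex
        · by_cases hS : (P S).projCount x = 0
          · have h1 := ha.projCount_eq_zero h hr hx hS
            have h2 := projCount_le_join (P := P) hex.choose x
            have h3 := hex.choose_spec
            omega
          · rw [eq_of_projCount_pos (h.projCount_le x) hex.choose_spec (Nat.pos_of_ne_zero hS)]
        · refine (hμ S x ?_).symm
          by_contra hS
          exact hex ⟨S, Nat.pos_of_ne_zero hS⟩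

/-- With weights 0 and 1, independent-or becomes an existential quantifier and the product a
conjunction. -/
theorem value_indicator {W : Finset (Σ r, attr r → C)} (hA : ∀ t ∈ W, ∀ i, t.2 i ∈ A)
    {P : Plan Rel V} (h : P.Proper q₀) (ha : P.Adapted q) (ν : V → C) :
    P.value q A (indicator W) ν = if P.HoldsIn q W ν then 1 else 0 := by
  induction P generalizing ν with
  | atom r =>
    simp only [value, indicator]
    have hiff : (atom r).HoldsIn q W ν ↔ q.ground ν r ∈ W := by
      refine ⟨?_, fun hr => ⟨ν, fun _ _ => rfl, fun s hs => ?_⟩⟩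
      · rintro ⟨μ, hμ, hW⟩
        rw [← show μ = ν from funext fun x => hμ x rfl]
        exact hW r (Finset.mem_singleton_self r)
      · rwa [Finset.mem_singleton.1 hs]
    by_cases hr : q.ground ν r ∈ W
    · rw [if_pos hr, if_pos (hiff.2 hr)]
    · rw [if_neg hr, if_neg fun h => hr (hiff.1 h)]
  | proj y P ih =>
    simp only [value, ih h.of_proj (ha.of_proj h)]
    split_ifs with hP
    · obtain ⟨τ, hτ, hP⟩ := (holdsIn_proj_iff h ha hA).1 hP
      rw [Finset.prod_eq_zero hτ (by rw [if_pos hP, sub_self]), sub_zero]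
    · rw [Finset.prod_eq_one, sub_self]
      intro τ hτ
      rw [if_neg fun hP' => hP ((holdsIn_proj_iff h ha hA).2 ⟨τ, hτ, hP'⟩), sub_zero]
  | join parts P ih =>
    simp only [value, ih _ (h.of_join _) (ha.of_join h _)]
    split_ifs with hP
    · exact Finset.prod_eq_one fun S _ => if_pos ((holdsIn_join_iff h ha).1 hP S)
    · rw [holdsIn_join_iff h ha, not_forall] at hP
      obtain ⟨S, hS⟩ := hP
      exact Finset.prod_eq_zero (Finset.mem_univ S) (if_neg hS)

/-- Extensional evaluation of an adapted plan computes the reliability. -/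
theorem reliability_eq_value {D : Database attr C} {P : Plan Rel V} (h : P.Proper q₀)
    (ha : P.Adapted q) (hrels : P.rels = q.rels) (hA : ∀ t ∈ D.tuples, ∀ i, t.2 i ∈ A)
    (hhead : ∀ x ∈ q.head, P.projCount x = 0)
    (hvars : ∀ r ∈ q.rels, ∀ x ∈ q.varsOf r, P.projCount x = 0 → x ∈ q.head) (ν : V → C) :
    reliability D q ν = P.value q A (weight D.tuples D.prob) ν := by
  rw [reliability_eq_expect, ← expect_value D.tuples D.prob h ha ν]
  refine expect_congr fun W hW => ?_
  rw [value_indicator (fun t ht => hA t (hW ht)) h ha]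
  refine if_congr ⟨?_, ?_⟩ rfl rfl
  · rintro ⟨μ, hμ, hμW⟩
    refine ⟨fun x => if P.projCount x = 0 then ν x else μ x, fun x hx => if_pos hx,
      fun r hr => ?_⟩
    rw [hrels] at hr
    rw [ground_congr (μ' := μ) fun x hx => ?_]
    · exact hμW r hr
    · split_ifs with h0
      · exact (hμ x (hvars r hr x hx h0)).symm
      · rfl
  · rintro ⟨μ, hμ, hμW⟩
    exact ⟨μ, fun x hx => hμ x (hhead x hx), fun r hr => hμW r (hrels ▸ hr)⟩

/-- A copy has the weight of its original as long as the new attributes take active values, which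
the projections guarantee below the root. -/
theorem value_dissociate {Δ : Rel → Finset V} {D : Database attr C} {P : Plan Rel V}
    (h : P.Proper q₀) (ha : P.Adapted (q.dissociate Δ)) (ν : V → C)
    (hν : ∀ r ∈ P.rels, ∀ x ∈ Δ r, P.projCount x = 0 → ν x ∈ D.activeDomain) :
    P.value (q.dissociate Δ) D.activeDomain
        (weight (D.dissociate Δ).tuples (D.dissociate Δ).prob) ν =
      P.value q D.activeDomain (weight D.tuples D.prob) ν := by
  induction P generalizing ν with
  | atom r =>
    simp only [value]
    have hy : ∀ y, ((q.dissociate Δ).ground ν r).2 (Sum.inr y) ∈ D.activeDomain := fun y =>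
      hν r (Finset.mem_singleton_self r) y.1 y.2 rfl
    exact weight_congr (Database.mem_tuples_dissociate.trans (and_iff_left hy)) rfl
  | proj y P ih =>
    simp only [value]
    refine congrArg (1 - ·) (Finset.prod_congr rfl fun τ hτ => ?_)
    refine congrArg (1 - ·) (ih h.of_proj (ha.of_proj h) _ fun r hr x hx hx0 => ?_)
    by_cases hxy : x ∈ y
    · rw [extend_of_mem hxy]
      exact Fintype.mem_piFinset.1 hτ _
    · rw [extend_of_notMem hxy]
      exact hν r hr x hx (by simp [projCount, hxy, hx0])
  | join parts P ih =>
    simp only [value]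
    refine Finset.prod_congr rfl fun S _ => ih S (h.of_join S) (ha.of_join h S) ν
      fun r hr x hx hx0 => hν r (mem_rels_join.2 ⟨S, hr⟩) x hx ?_
    refine ha.projCount_eq_zero h hr ?_ hx0
    rw [Query.varsOf_dissociate]
    exact Finset.mem_union_right _ hx

/-- The score of a plan is the reliability of the corresponding dissociation. -/
theorem IsPlanFor.score_eq_reliability {P : Plan Rel V} (h : P.IsPlanFor q) (D : Database attr C)
    (ν : V → C) :
    P.score D q ν =
      reliability (D.dissociate (P.dissociation q)) (q.dissociate (P.dissociation q)) ν := by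
  have hvar : ∀ r ∈ q.rels, ∀ x, x ∈ (q.dissociate (P.dissociation q)).varsOf r →
      P.projCount x = 0 → x ∈ q.head := by
    intro r hr x hx h0
    by_contra hxh
    have := h.scope_eq hr
    rw [Query.varsOf_dissociate] at hx
    have hx' : x ∈ P.scope r := by
      rw [this]
      exact Finset.mem_sdiff.2 ⟨hx, hxh⟩
    have := projCount_pos_of_mem_scope hx'
    omega
  have ha : P.Adapted (q.dissociate (P.dissociation q)) := by
    intro r hr x
    rw [h.2.1] at hr
    rw [Query.varsOf_dissociate, h.scope_eq hr, Finset.mem_sdiff]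
    refine and_congr_right fun hx => ⟨fun hxh => ?_, fun h0 hxh => ?_⟩
    · by_contra h0
      exact hxh (hvar r hr x (by rwa [Query.varsOf_dissociate]) (by omega))
    · have := h.2.2.2.2 x hxh
      omega
  rw [score_eq_value, reliability_eq_value (A := D.activeDomain) h.proper ha h.2.1
    (fun t ht => Database.mem_activeDomain_of_dissociate ht) h.2.2.2.2 hvar,
    value_dissociate h.proper ha]
  -- Every dissociated variable lies in the scope, hence is projected away, so no condition on `ν`
  -- is left at the root.
  intro r hr x hx h0
  rw [h.dissociation_eq] at hx
  have := projCount_pos_of_mem_scope (Finset.mem_sdiff.1 hx).1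
  omega

end Plan

end

end ProbDB

/-! ### The main theorem. -/

theorem mainTheorem5 {Rel V C : Type*} {attr : Rel → Type*} [∀ r, Fintype (attr r)]
    (q : ProbDB.Query attr V C) (hbody : q.rels.Nonempty) (hhead : q.head ⊆ q.vars) :
    -- the algorithm enumerates exactly the minimal query plans
    (∀ P : ProbDB.Plan Rel V, P ∈ ProbDB.MP q ↔ P.IsMinimalFor q) ∧
    -- soundness
    (∀ P ∈ ProbDB.MP q, P.IsPlanFor q ∧
      ∀ P' : ProbDB.Plan Rel V, P'.IsPlanFor q → ¬ ProbDB.Plan.Dominates q P' P) ∧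
    -- completeness, for every database and every answer
    (∀ (D : ProbDB.Database attr C) (ν : V → C),
      IsLeast {p : ℝ | ∃ Δ, q.IsSafeDissociation Δ ∧
          p = ProbDB.reliability (D.dissociate Δ) (q.dissociate Δ) ν}
        (ProbDB.propagationScore D q ν) ∧
      IsLeast {p : ℝ | ∃ P ∈ ProbDB.MP q, p = P.score D q ν}
        (ProbDB.propagationScore D q ν)) := by
  have hmp := ProbDB.mem_MP_iff_isMinimalFor hhead hbody
  refine ⟨hmp, fun P hP => ⟨((hmp P).1 hP).1, fun P' hP' =>
    ProbDB.not_dominates_of_isMinimalFor ((hmp P).1 hP) hP'⟩, fun D ν => ?_⟩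
  -- every safe dissociation is bounded below by the score of a plan returned by the algorithm
  have hbound : ∀ Δ, q.IsSafeDissociation Δ → ∃ P ∈ ProbDB.MP q,
      P.score D q ν ≤ ProbDB.reliability (D.dissociate Δ) (q.dissociate Δ) ν := by
    intro Δ hΔ
    obtain ⟨P, hP, hle⟩ := ProbDB.exists_mem_MP_dissociation_le hhead hbody hΔ
    refine ⟨P, hP, ?_⟩
    rw [((hmp P).1 hP).1.score_eq_reliability]
    exact ProbDB.reliability_dissociate_mono hΔ.1 hle ν
  obtain ⟨P, hP, hmin⟩ := Finset.exists_min_image (ProbDB.MP q) (fun P => P.score D q ν)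
    (ProbDB.MP_nonempty hhead hbody)
  -- There may be infinitely many candidate databases but only finitely many plans: the best plan's
  -- own dissociation is safe and attains the minimum.
  have hleast : IsLeast {p : ℝ | ∃ Δ, q.IsSafeDissociation Δ ∧
      p = ProbDB.reliability (D.dissociate Δ) (q.dissociate Δ) ν} (P.score D q ν) := by
    refine ⟨⟨_, ((hmp P).1 hP).2.prop, ((hmp P).1 hP).1.score_eq_reliability D ν⟩, ?_⟩
    rintro _ ⟨Δ, hΔ, rfl⟩
    obtain ⟨P', hP', hle⟩ := hbound Δ hΔ
    exact (hmin P' hP').trans hle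
  rw [show ProbDB.propagationScore D q ν = P.score D q ν from hleast.csInf_eq]
  refine ⟨hleast, ⟨P, hP, rfl⟩, ?_⟩
  rintro _ ⟨P', hP', rfl⟩
  exact hmin P' hP'
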